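/- Let $0<\mu<1$, $E=(-\tfrac12,0)$, $M=(\tfrac12,0)$, and let $H(q,p)=\tfrac12|p|^2-\frac{1-\mu}{|q-E|}-\frac{\mu}{|q-M|}$ on $P=(\mathbb R^2\setminus\{E,M\})\times\mathbb R^2$ be the Hamiltonian of the Euler problem of two fixed centres (Earth $E$, Moon $M$). Let $c_J=-1-2\sqrt{\mu(1-\mu)}$ be the critical Jacobi energy, i.e. the value of $H$ at its critical point $(l-\tfrac12,0,0,0)$, where $l=\frac{1-\mu-\sqrt{\mu(1-\mu)}}{1-2\mu}$ if $\mu\ne\frac12$ and $l=\frac12$ if $\mu=\frac12$. For $c<c_J$ let $\Sigma^E_c$ be the Earth component of $H^{-1}(c)$, i.e. the set of points whose connected component in $H^{-1}(c)$ has a projection to the $q$-plane that accumulates at $E$. Doubly-covered elliptic coordinates are given by $\Phi(\lambda,\nu,p_\lambda,p_\nu)=(q,p)$ with $q_1=\frac12\cosh\lambda\cos\nu$, $q_2=\frac12\sinh\lambda\sin\nu$ and $p_\lambda d\lambda+p_\nu d\nu=p_1dq_1+p_2dq_2$; let $D\subset\mathbb R^4$ be the set of $(\lambda,\nu,p_\lambda,p_\nu)$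 with $q\notin\{E,M\}$. Let $Q_c=Q^1+Q^2$ with $Q^1=2p_\lambda^2-2\cosh\lambda-c\cosh^2\lambda$ and $Q^2=2p_\nu^2+2(1-2\mu)\cos\nu+c\cos^2\nu$. Let $S_c\subset\mathbb R^4$, the image of the regularized Earth component, be the closure of $\{(\lambda,\nu,p_\lambda,p_\nu): \nu\in[0,2\pi],\ \Phi(\lambda,\nu,p_\lambda,p_\nu)\in\Sigma^E_c\}$. Call $S_c$ strictly convex if $\nabla Q_c\neq0$ on $S_c$, the Gauss–Kronecker curvature of $S_c$ (with respect to the normal $\nabla Q_c/|\nabla Q_c|$, the sign being such that round spheres with outer normal have positive curvature) is positive everywhere, and $S_c$ is the boundary of a compact strictly convex body. Then: 1. On $D$ the map $\Phi$ is smooth, preserves the Liouville form, hence the symplectic form $dp_1\wedge dq_1+dp_2\wedge dq_2$, and it is 2-to-1 onto $P$ when $\nu$ is taken modulo $2\pi$; moreover $\cosh\lambda=|q-E|+|q-M|$ and $\cos\nu=|q-E|-|q-M|$. 2. For every $c<c_J$: $Q_c=(H\circ\Phi-c)(\cosh^2\lambda-\cos^2\nu)$ on $D$; $S_c$ is compact,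 it is a connected component of $Q_c^{-1}(0)$, and $\nabla Q_c\ne0$ on $S_c$; the involution $\sigma(\lambda,\nu,p_\lambda,p_\nu)=(-\lambda,2\pi-\nu,-p_\lambda,-p_\nu)$ acts on $S_c$ without fixed points; and $\Phi$ maps $S_c\cap D$ onto $\Sigma^E_c$ with fibres exactly the pairs $\{z,\sigma(z)\}$. 3. If $\mu\ge\frac12$, then $S_c$ is strictly convex for every $c<c_J$. 4. If $\mu<\frac12$, there is $c_0=c_0(\mu)<c_J$ such that $S_c$ is strictly convex for every $c<c_0$, whereas for every $c$ with $c_0\le c<c_J$ it is not: its Gauss–Kronecker curvature is $\le0$ at some point, and for $c_0<c<c_J$ it is not even the boundary of a compact convex body with non-empty interior. -/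

import Mathlib

open Set
open scoped ContDiff

noncomputable section

namespace TwoCentre

/-- The plane `ℝ²` with its Euclidean metric. -/
abbrev Plane : Type := EuclideanSpace ℝ (Fin 2)

/-- `ℝ⁴` with its Euclidean metric. Its points are written either as `(q₁, q₂, p₁, p₂)` (Cartesian
canonical coordinates) or as `(lam, nu, p_lam, p_nu)` (elliptic canonical coordinates). -/
abbrev Phase : Type := EuclideanSpace ℝ (Fin 4)

/-! ### The Euler problem of two fixed centres -/

/-- The Earth, after the translation that puts the origin midway between the primaries. -/
def earth : Plane := !₂[-1 / 2, 0]

/-- The Moon. -/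
def moon : Plane := !₂[1 / 2, 0]

/-- The projection `(q, p) ↦ q` along the fibre. -/
def position (x : Phase) : Plane := !₂[x 0, x 1]

/-- The phase space `(ℝ² ∖ {E, M}) × ℝ²`. -/
def phaseSpace : Set Phase := {x | position x ≠ earth ∧ position x ≠ moon}

/-- The potential `U(q) = -(1 - μ)/|q - E| - μ/|q - M|` (used on `ℝ² ∖ {E, M}` only). -/
def potential (μ : ℝ) (q : Plane) : ℝ := -(1 - μ) / dist q earth - μ / dist q moon

/-- The Hamiltonian `H(q, p) = |p|²/2 + U(q)` (used on `phaseSpace` only). -/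
def hamiltonian (μ : ℝ) (x : Phase) : ℝ :=
  (x 2 ^ 2 + x 3 ^ 2) / 2 + potential μ (position x)

/-- The number `l`, the distance from the Earth to the equilibrium between the primaries. -/
def lagrangeDist (μ : ℝ) : ℝ :=
  if μ = 1 / 2 then 1 / 2 else (1 - μ - √(μ * (1 - μ))) / (1 - 2 * μ)

/-- The critical point `L` of `H` (shifted, like the primaries, by `-1/2`). -/
def lagrangePoint (μ : ℝ) : Phase := !₂[lagrangeDist μ - 1 / 2, 0, 0, 0]

/-- The critical Jacobi energy `c_J = H(L)`. -/
def criticalEnergy (μ : ℝ) : ℝ := hamiltonian μ (lagrangePoint μ)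

/-- The energy hypersurface `H⁻¹(c)`. -/
def energySurface (μ c : ℝ) : Set Phase := {x | x ∈ phaseSpace ∧ hamiltonian μ x = c}

/-- The Earth component of `H⁻¹(c)`: the points whose connected component in `H⁻¹(c)` has a
projection to the `q`-plane that accumulates at the Earth. -/
def earthComponent (μ c : ℝ) : Set Phase :=
  {x | x ∈ energySurface μ c ∧
    earth ∈ closure (position '' connectedComponentIn (energySurface μ c) x)}

/-! ### Doubly-covered elliptic coordinates and the regularization -/

/-- Doubly-covered elliptic coordinates, `(lam, nu, p_lam, p_nu) ↦ (q₁, q₂, p₁, p₂)`, where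
`q₁ = cosh lam cos nu / 2`, `q₂ = sinh lam sin nu / 2`, and `p₁, p₂` solve the linear system
`p_lam d lam + p_nu d nu = p₁ dq₁ + p₂ dq₂` (meaningful where `q` is not one of the primaries,
that is, where `cosh² lam - cos² nu ≠ 0`). -/
def ellipticMap (z : Phase) : Phase :=
  !₂[Real.cosh (z 0) * Real.cos (z 1) / 2,
    Real.sinh (z 0) * Real.sin (z 1) / 2,
    2 * (Real.sinh (z 0) * Real.cos (z 1) * z 2 - Real.cosh (z 0) * Real.sin (z 1) * z 3) /
      (Real.cosh (z 0) ^ 2 - Real.cos (z 1) ^ 2),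
    2 * (Real.cosh (z 0) * Real.sin (z 1) * z 2 + Real.sinh (z 0) * Real.cos (z 1) * z 3) /
      (Real.cosh (z 0) ^ 2 - Real.cos (z 1) ^ 2)]

/-- The set of elliptic coordinates of non-collision states. -/
def ellipticDomain : Set Phase := ellipticMap ⁻¹' phaseSpace

/-- The involution `(lam, nu, p_lam, p_nu) ↦ (-lam, 2π - nu, -p_lam, -p_nu)` of `ℝ⁴`. -/
def deck (z : Phase) : Phase := !₂[-z 0, 2 * Real.pi - z 1, -z 2, -z 3]

/-- The Liouville form `p₁ dq₁ + p₂ dq₂` at `x`, evaluated at the vector `v`. -/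
def liouville (x v : Phase) : ℝ := x 2 * v 0 + x 3 * v 1

/-- The standard symplectic form `dp₁ ∧ dq₁ + dp₂ ∧ dq₂`. -/
def symplecticForm (v w : Phase) : ℝ :=
  (v 2 * w 0 - v 0 * w 2) + (v 3 * w 1 - v 1 * w 3)

/-- `Q¹ = 2 p_lam² - 2 cosh lam - c cosh² lam`. -/
def Q1 (c : ℝ) (z : Phase) : ℝ :=
  2 * z 2 ^ 2 - 2 * Real.cosh (z 0) - c * Real.cosh (z 0) ^ 2

/-- `Q² = 2 p_nu² + 2 (1 - 2μ) cos nu + c cos² nu`. -/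
def Q2 (μ c : ℝ) (z : Phase) : ℝ :=
  2 * z 3 ^ 2 + 2 * (1 - 2 * μ) * Real.cos (z 1) + c * Real.cos (z 1) ^ 2

/-- The regularized Hamiltonian `Q_c = Q¹ + Q²`. -/
def regHamiltonian (μ c : ℝ) (z : Phase) : ℝ := Q1 c z + Q2 μ c z

/-- The image in `ℝ⁴` of the regularized Earth component: the Earth component of `H⁻¹(c)` is read
in elliptic coordinates with `nu ∈ [0, 2π]`, and the collision states are added by taking the
closure. -/
def regEarthComponent (μ c : ℝ) : Set Phase :=
  closure {z : Phase | z 1 ∈ Icc 0 (2 * Real.pi) ∧ ellipticMap z ∈ earthComponent μ c}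

/-! ### Convexity of hypersurfaces -/

/-- The tangent space at `z` of the level set of `F` through a regular point `z`. -/
abbrev tangentAt (F : Phase → ℝ) (z : Phase) : Submodule ℝ Phase := (ℝ ∙ gradient F z)ᗮ

/-- The unit normal field of the level sets of `F`, pointing towards larger values of `F`. -/
def unitNormal (F : Phase → ℝ) (z : Phase) : Phase := ‖gradient F z‖⁻¹ • gradient F z

/-- The shape operator `v ↦ dN(v)` on the tangent space at `z`, where `N` is the unit normal field.
With this sign it is positive for a sphere with its outer normal. -/
def shapeOperator (F : Phase → ℝ) (z : Phase) : tangentAt F z →ₗ[ℝ] tangentAt F z :=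
  ((tangentAt F z).orthogonalProjectionOnto ∘L fderiv ℝ (unitNormal F) z ∘L
    (tangentAt F z).subtypeL).toLinearMap

/-- The Gauss–Kronecker curvature at a regular point `z` of the level set of `F` through `z`. -/
def gaussKronecker (F : Phase → ℝ) (z : Phase) : ℝ := LinearMap.det (shapeOperator F z)

/-- The hypersurface `S` is the boundary of a compact convex body. -/
def BoundsConvexBody (S : Set Phase) : Prop :=
  ∃ B : Set Phase, IsCompact B ∧ (interior B).Nonempty ∧ Convex ℝ B ∧ frontier B = S

/-- The hypersurface `S` is the boundary of a compact strictly convex body. -/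
def BoundsStrictlyConvexBody (S : Set Phase) : Prop :=
  ∃ B : Set Phase, IsCompact B ∧ (interior B).Nonempty ∧ StrictConvex ℝ B ∧ frontier B = S

/-- A hypersurface `S`, contained in a level set of `F` and with outer normal in the direction of
the gradient of `F`, is strictly convex in the differential-geometric sense: it is regular, has
positive Gauss–Kronecker curvature everywhere, and bounds a strictly convex body. -/
structure IsStrictlyConvexHypersurface (F : Phase → ℝ) (S : Set Phase) : Prop where
  regular : ∀ z ∈ S, gradient F z ≠ 0
  curvature_pos : ∀ z ∈ S, 0 < gaussKronecker F z
  bounds : BoundsStrictlyConvexBody S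

end TwoCentre

end

/-!
The regularized Hamiltonian separates: with `m = 1 - 2μ` and `k = -c` it is
`Q = V(lam) + W(nu) + 2 p_lam² + 2 p_nu²`, where `V = k cosh² - 2 cosh` and `W = 2 m cos - k cos²`,
and `c < c_J` means `k > 1` and `k² - 2 k + m² > 0` (`Subcritical`). The two distances to the
primaries are `(cosh lam ± cos nu) / 2`, which gives the fibres of the elliptic coordinates; the
symplectic identities follow by differentiating the linear system that defines the momenta.

**Topology.** Below the critical energy no state lies over `cos nu = m / k`, so the level set
`Q = 0` splits there, and the Earth side is the boundary of a compact body that is strictly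
star-shaped about the lift of the Earth: along rays from this centre each of the four terms of `Q`
increases (`isStarBody_well`). Radial projection then shows that the surface is connected, and that
its noncollision part is connected and dense in it, because the complement of a plane in
`ℝ⁴` is connected and dense. Hence the Earth component is the image of the noncollision part of the surface (`image_wellSurface`), and the closure in the definition of `regEarthComponent`
restores the whole surface (`regEarthComponent_eq`).

**Curvature.** For a sum of functions `fᵢ` of one variable the Gauss–Kronecker curvature is
`|∇|⁻⁵ Σᵢ fᵢ'² ∏_{j ≠ i} fⱼ''`, computed in the orthonormal frame `i n, j n, k n` obtained from the
unit normal `n` by quaternion multiplication (`gaussKronecker_separable`). On `Q = 0` its sign is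
that of `W'' (V'² - 2 V V'') + V'' (W'² - 2 W W'')`. Here `V'' > 0`, and `V'² / V'' - 2 V` is largest
at `lam = 0` (`lamPotDeriv_sq_le`), so the curvature is positive as soon as a quartic polynomial in
`y = cos nu`, the `criterion`, is positive over the well (`curvatureForm_pos`); at `lam = 0` the two
signs agree. Positive curvature makes `Q` increase to both sides of a point of tangency along a
tangent line, and contracting segments towards the centre turns this local property into strict
convexity of the body (`IsStarBody.strictConvex`).

**The threshold.** The criterion is positive over the well where `y ≤ 0`, which settles `m ≤ 0`, that
is, `μ ≥ 1/2`. For `m > 0` it has at most one critical point inside the well, `y = m / (4 k)`, and its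
value there is a strictly increasing function of `k`, negative at the critical energy and positive at `k = 2`; its
zero is the threshold `-c₀`. Where that value is negative, a tangent line at a state over this point
runs inside the open well on both sides of the point of tangency, and the well lies in every convex
body bounded by the surface, which contradicts the point being on the boundary
(`not_boundsConvexBody`).
-/


open Set
open scoped ContDiff

noncomputable section

namespace TwoCentre

/-! ### Elliptic coordinates -/

@[simp] lemma ellipticMap_zero (z : Phase) :
    ellipticMap z 0 = Real.cosh (z 0) * Real.cos (z 1) / 2 := by simp [ellipticMap]

@[simp] lemma ellipticMap_one (z : Phase) :
    ellipticMap z 1 = Real.sinh (z 0) * Real.sin (z 1) / 2 := by simp [ellipticMap]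

lemma ellipticMap_two (z : Phase) : ellipticMap z 2 =
    2 * (Real.sinh (z 0) * Real.cos (z 1) * z 2 - Real.cosh (z 0) * Real.sin (z 1) * z 3) /
      (Real.cosh (z 0) ^ 2 - Real.cos (z 1) ^ 2) := by simp [ellipticMap]

lemma ellipticMap_three (z : Phase) : ellipticMap z 3 =
    2 * (Real.cosh (z 0) * Real.sin (z 1) * z 2 + Real.sinh (z 0) * Real.cos (z 1) * z 3) /
      (Real.cosh (z 0) ^ 2 - Real.cos (z 1) ^ 2) := by simp [ellipticMap]

lemma phase_ext {x y : Phase} (h0 : x 0 = y 0) (h1 : x 1 = y 1) (h2 : x 2 = y 2)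
    (h3 : x 3 = y 3) : x = y := by
  ext i
  fin_cases i <;> assumption

lemma dist_earth (x : Phase) :
    dist (position x) earth = √((x 0 + 1 / 2) ^ 2 + x 1 ^ 2) := by
  rw [EuclideanSpace.dist_eq]
  simp only [Fin.sum_univ_two, position, earth, Real.dist_eq, sq_abs]
  simp
  ring_nf

lemma dist_moon (x : Phase) :
    dist (position x) moon = √((x 0 - 1 / 2) ^ 2 + x 1 ^ 2) := by
  rw [EuclideanSpace.dist_eq]
  simp only [Fin.sum_univ_two, position, moon, Real.dist_eq, sq_abs]
  simp

lemma dist_earth_moon : dist earth moon = 1 := by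
  rw [EuclideanSpace.dist_eq]
  simp only [Fin.sum_univ_two, earth, moon, Real.dist_eq, sq_abs]
  simp
  norm_num

lemma dist_ellipticMap_earth (z : Phase) :
    dist (position (ellipticMap z)) earth = (Real.cosh (z 0) + Real.cos (z 1)) / 2 := by
  have h1 := Real.one_le_cosh (z 0)
  have h2 := Real.neg_one_le_cos (z 1)
  have h : (ellipticMap z 0 + 1 / 2) ^ 2 + ellipticMap z 1 ^ 2
      = ((Real.cosh (z 0) + Real.cos (z 1)) / 2) ^ 2 := by
    simp only [ellipticMap_zero, ellipticMap_one, div_pow, mul_pow, Real.sinh_sq, Real.sin_sq]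
    ring
  rw [dist_earth, h, Real.sqrt_sq (by linarith)]

lemma dist_ellipticMap_moon (z : Phase) :
    dist (position (ellipticMap z)) moon = (Real.cosh (z 0) - Real.cos (z 1)) / 2 := by
  have h1 := Real.one_le_cosh (z 0)
  have h2 := Real.cos_le_one (z 1)
  have h : (ellipticMap z 0 - 1 / 2) ^ 2 + ellipticMap z 1 ^ 2
      = ((Real.cosh (z 0) - Real.cos (z 1)) / 2) ^ 2 := by
    simp only [ellipticMap_zero, ellipticMap_one, div_pow, mul_pow, Real.sinh_sq, Real.sin_sq]
    ring
  rw [dist_moon, h, Real.sqrt_sq (by linarith)]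

lemma mem_phaseSpace_iff_dist {x : Phase} :
    x ∈ phaseSpace ↔ dist (position x) earth ≠ 0 ∧ dist (position x) moon ≠ 0 := by
  simp [phaseSpace]

lemma mem_ellipticDomain {z : Phase} :
    z ∈ ellipticDomain ↔ Real.cosh (z 0) ^ 2 - Real.cos (z 1) ^ 2 ≠ 0 := by
  have h : Real.cosh (z 0) ^ 2 - Real.cos (z 1) ^ 2
      = 4 * (dist (position (ellipticMap z)) earth * dist (position (ellipticMap z)) moon) := by
    rw [dist_ellipticMap_earth, dist_ellipticMap_moon]
    ring
  rw [h, ellipticDomain, mem_preimage, mem_phaseSpace_iff_dist]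
  simp

/-- The conformal factor as a sum of squares. -/
lemma sq_add_sq_eq_cosh_sq_sub_cos_sq (a b : ℝ) :
    (Real.sinh a * Real.cos b) ^ 2 + (Real.cosh a * Real.sin b) ^ 2
      = Real.cosh a ^ 2 - Real.cos b ^ 2 := by
  rw [mul_pow, mul_pow, Real.sinh_sq, Real.sin_sq]
  ring

/-- Away from the primaries the momenta are determined by the linear system
`p_lam d lam + p_nu d nu = p₁ dq₁ + p₂ dq₂`. -/
lemma ellipticMap_eq_iff {z x : Phase} (hz : Real.cosh (z 0) ^ 2 - Real.cos (z 1) ^ 2 ≠ 0) :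
    ellipticMap z = x ↔ Real.cosh (z 0) * Real.cos (z 1) / 2 = x 0 ∧
      Real.sinh (z 0) * Real.sin (z 1) / 2 = x 1 ∧
      z 2 = (x 2 * (Real.sinh (z 0) * Real.cos (z 1)) +
        x 3 * (Real.cosh (z 0) * Real.sin (z 1))) / 2 ∧
      z 3 = (-x 2 * (Real.cosh (z 0) * Real.sin (z 1)) +
        x 3 * (Real.sinh (z 0) * Real.cos (z 1))) / 2 := by
  have hs := sq_add_sq_eq_cosh_sq_sub_cos_sq (z 0) (z 1)
  constructor
  · rintro rfl
    refine ⟨by simp, by simp, ?_, ?_⟩ <;> rw [ellipticMap_two, ellipticMap_three] <;>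
      field_simp <;> rw [← hs] <;> ring
  · rintro ⟨h0, h1, h2, h3⟩
    refine phase_ext (by simpa using h0) (by simpa using h1) ?_ ?_
    · rw [ellipticMap_two, h2, h3]
      field_simp
      rw [← hs]
      ring
    · rw [ellipticMap_three, h2, h3]
      field_simp
      rw [← hs]
      ring

lemma isOpen_ellipticDomain : IsOpen ellipticDomain := by
  have : ellipticDomain = {z : Phase | Real.cosh (z 0) ^ 2 - Real.cos (z 1) ^ 2 ≠ 0} := by
    ext z
    exact mem_ellipticDomain
  rw [this]
  exact isOpen_ne_fun (by fun_prop) (by fun_prop)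

lemma contDiffOn_ellipticMap : ContDiffOn ℝ ∞ ellipticMap ellipticDomain := by
  have hp : ∀ i : Fin 4, ContDiffOn ℝ ∞ (fun z : Phase => z i) ellipticDomain := fun i =>
    (contDiff_euclidean.1 contDiff_id i).contDiffOn
  have hd : ∀ z ∈ ellipticDomain, Real.cosh (z 0) ^ 2 - Real.cos (z 1) ^ 2 ≠ 0 :=
    fun z hz => mem_ellipticDomain.1 hz
  have c0 := (hp 0).cosh
  have s0 := (hp 0).sinh
  have c1 := (hp 1).cos
  have s1 := (hp 1).sin
  have hden := (c0.pow 2).sub (c1.pow 2)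
  rw [contDiffOn_euclidean]
  intro i
  fin_cases i
  · simpa using (c0.mul c1).div_const 2
  · simpa using (s0.mul s1).div_const 2
  · simp only [Fin.reduceFinMk, ellipticMap_two]
    exact (contDiffOn_const.mul (((s0.mul c1).mul (hp 2)).sub ((c0.mul s1).mul (hp 3)))).div
      hden hd
  · simp only [Fin.reduceFinMk, ellipticMap_three]
    exact (contDiffOn_const.mul (((c0.mul s1).mul (hp 2)).add ((s0.mul c1).mul (hp 3)))).div
      hden hd

lemma continuous_position_ellipticMap : Continuous fun z => position (ellipticMap z) := by
  unfold position
  simp only [ellipticMap_zero, ellipticMap_one]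
  fun_prop

/-! ### The elliptic coordinates are symplectic -/

lemma hasDerivAt_coord (z v : Phase) (i : Fin 4) :
    HasDerivAt (fun t : ℝ => (z + t • v) i) (v i) 0 := by
  simpa using ((hasDerivAt_id (0 : ℝ)).mul_const (v i)).const_add (z i)

lemma hasDerivAt_ellipticMap_line {z : Phase} (hz : z ∈ ellipticDomain) (v : Phase) (i : Fin 4) :
    HasDerivAt (fun t : ℝ => ellipticMap (z + t • v) i) (fderiv ℝ ellipticMap z v i) 0 := by
  have h : HasFDerivAt ellipticMap (fderiv ℝ ellipticMap z) (z + (0 : ℝ) • v) := by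
    rw [zero_smul, add_zero]
    exact ((contDiffOn_ellipticMap.contDiffAt (isOpen_ellipticDomain.mem_nhds hz)).differentiableAt
      (by simp)).hasFDerivAt
  have hl : HasDerivAt (fun t : ℝ => z + t • v) v 0 := by
    simpa using ((hasDerivAt_id (0 : ℝ)).smul_const v).const_add z
  have := (h.comp_hasDerivAt (0 : ℝ) hl)
  have hproj := (EuclideanSpace.proj i : Phase →L[ℝ] ℝ).hasFDerivAt
    (x := (ellipticMap ∘ fun t : ℝ => z + t • v) 0)
  exact hproj.comp_hasDerivAt (0 : ℝ) this

lemma fderiv_ellipticMap_zero {z : Phase} (hz : z ∈ ellipticDomain) (v : Phase) :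
    fderiv ℝ ellipticMap z v 0 = (Real.sinh (z 0) * Real.cos (z 1) * v 0 -
      Real.cosh (z 0) * Real.sin (z 1) * v 1) / 2 := by
  refine (hasDerivAt_ellipticMap_line hz v 0).unique ?_
  simp only [ellipticMap_zero]
  refine ((((hasDerivAt_coord z v 0).cosh).mul ((hasDerivAt_coord z v 1).cos)).div_const 2).congr_deriv
    ?_
  simp only [zero_smul, add_zero]
  ring

lemma fderiv_ellipticMap_one {z : Phase} (hz : z ∈ ellipticDomain) (v : Phase) :
    fderiv ℝ ellipticMap z v 1 = (Real.cosh (z 0) * Real.sin (z 1) * v 0 +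
      Real.sinh (z 0) * Real.cos (z 1) * v 1) / 2 := by
  refine (hasDerivAt_ellipticMap_line hz v 1).unique ?_
  simp only [ellipticMap_one]
  refine ((((hasDerivAt_coord z v 0).sinh).mul ((hasDerivAt_coord z v 1).sin)).div_const 2).congr_deriv
    ?_
  simp only [zero_smul, add_zero]
  ring

lemma momentum_eq {z : Phase} (hz : z ∈ ellipticDomain) :
    z 2 = (ellipticMap z 2 * (Real.sinh (z 0) * Real.cos (z 1)) +
        ellipticMap z 3 * (Real.cosh (z 0) * Real.sin (z 1))) / 2 ∧
      z 3 = (-ellipticMap z 2 * (Real.cosh (z 0) * Real.sin (z 1)) +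
        ellipticMap z 3 * (Real.sinh (z 0) * Real.cos (z 1))) / 2 :=
  ((ellipticMap_eq_iff (mem_ellipticDomain.1 hz)).1 rfl).2.2

lemma liouville_ellipticMap {z : Phase} (hz : z ∈ ellipticDomain) (v : Phase) :
    liouville (ellipticMap z) (fderiv ℝ ellipticMap z v) = liouville z v := by
  obtain ⟨h2, h3⟩ := momentum_eq hz
  rw [liouville, liouville, fderiv_ellipticMap_zero hz, fderiv_ellipticMap_one hz, h2, h3]
  ring

lemma eventually_line_mem_ellipticDomain {z : Phase} (hz : z ∈ ellipticDomain) (v : Phase) :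
    ∀ᶠ t : ℝ in nhds 0, z + t • v ∈ ellipticDomain := by
  have hc : Continuous fun t : ℝ => z + t • v := by fun_prop
  exact hc.continuousAt.eventually_mem (isOpen_ellipticDomain.mem_nhds (by simpa using hz))

/-- The linear system for the momenta, differentiated: this relates the derivatives of `p₁, p₂` to
the components of `v` without differentiating the quotients that define `p₁, p₂`. -/
lemma fderiv_momentum {z : Phase} (hz : z ∈ ellipticDomain) (v : Phase) :
    v 2 = (fderiv ℝ ellipticMap z v 2 * (Real.sinh (z 0) * Real.cos (z 1)) +
        ellipticMap z 2 * (Real.cosh (z 0) * Real.cos (z 1) * v 0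
          - Real.sinh (z 0) * Real.sin (z 1) * v 1) +
        fderiv ℝ ellipticMap z v 3 * (Real.cosh (z 0) * Real.sin (z 1)) +
        ellipticMap z 3 * (Real.sinh (z 0) * Real.sin (z 1) * v 0
          + Real.cosh (z 0) * Real.cos (z 1) * v 1)) / 2 ∧
    v 3 = (-fderiv ℝ ellipticMap z v 2 * (Real.cosh (z 0) * Real.sin (z 1)) -
        ellipticMap z 2 * (Real.sinh (z 0) * Real.sin (z 1) * v 0
          + Real.cosh (z 0) * Real.cos (z 1) * v 1) +
        fderiv ℝ ellipticMap z v 3 * (Real.sinh (z 0) * Real.cos (z 1)) +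
        ellipticMap z 3 * (Real.cosh (z 0) * Real.cos (z 1) * v 0
          - Real.sinh (z 0) * Real.sin (z 1) * v 1)) / 2 := by
  have h2 := hasDerivAt_ellipticMap_line hz v 2
  have h3 := hasDerivAt_ellipticMap_line hz v 3
  have hsc := ((hasDerivAt_coord z v 0).sinh).mul ((hasDerivAt_coord z v 1).cos)
  have hcs := ((hasDerivAt_coord z v 0).cosh).mul ((hasDerivAt_coord z v 1).sin)
  have hev := eventually_line_mem_ellipticDomain hz v
  constructor
  · refine ((hasDerivAt_coord z v 2).congr_of_eventuallyEq (f₁ := fun t : ℝ => _)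
      (hev.mono fun t ht => (momentum_eq ht).1.symm)).unique ?_
    refine (((h2.mul hsc).add (h3.mul hcs)).div_const 2).congr_deriv ?_
    simp only [zero_smul, add_zero, Pi.mul_apply]
    ring
  · refine ((hasDerivAt_coord z v 3).congr_of_eventuallyEq (f₁ := fun t : ℝ => _)
      (hev.mono fun t ht => (momentum_eq ht).2.symm)).unique ?_
    refine (((h2.neg.mul hcs).add (h3.mul hsc)).div_const 2).congr_deriv ?_
    simp only [zero_smul, add_zero, Pi.mul_apply, Pi.neg_apply]
    ring

lemma symplecticForm_ellipticMap {z : Phase} (hz : z ∈ ellipticDomain) (v w : Phase) :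
    symplecticForm (fderiv ℝ ellipticMap z v) (fderiv ℝ ellipticMap z w)
      = symplecticForm v w := by
  obtain ⟨hv2, hv3⟩ := fderiv_momentum hz v
  obtain ⟨hw2, hw3⟩ := fderiv_momentum hz w
  rw [symplecticForm, symplecticForm, fderiv_ellipticMap_zero hz v, fderiv_ellipticMap_one hz v,
    fderiv_ellipticMap_zero hz w, fderiv_ellipticMap_one hz w, hv2, hv3, hw2, hw3]
  ring

/-! ### The fibres of the elliptic coordinates -/

/-- The other point over `ellipticMap z`: the involution `deck`, with `nu` reduced modulo `2π` so that
`[0, 2π)` is preserved. -/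
def partner (z : Phase) : Phase :=
  !₂[-z 0, if z 1 = 0 then 0 else 2 * Real.pi - z 1, -z 2, -z 3]

lemma partner_eq_deck {z : Phase} (hz : z 1 ≠ 0) : partner z = deck z := by
  simp [partner, deck, hz]

@[simp] lemma deck_zero (z : Phase) : deck z 0 = -z 0 := by simp [deck]
@[simp] lemma deck_one (z : Phase) : deck z 1 = 2 * Real.pi - z 1 := by simp [deck]
@[simp] lemma deck_two (z : Phase) : deck z 2 = -z 2 := by simp [deck]
@[simp] lemma deck_three (z : Phase) : deck z 3 = -z 3 := by simp [deck]

@[simp] lemma partner_zero (z : Phase) : partner z 0 = -z 0 := by simp [partner]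
@[simp] lemma partner_one (z : Phase) :
    partner z 1 = if z 1 = 0 then 0 else 2 * Real.pi - z 1 := by simp [partner]
@[simp] lemma partner_two (z : Phase) : partner z 2 = -z 2 := by simp [partner]
@[simp] lemma partner_three (z : Phase) : partner z 3 = -z 3 := by simp [partner]

lemma cos_partner (z : Phase) : Real.cos (partner z 1) = Real.cos (z 1) := by
  rw [partner_one]
  split_ifs with h
  · rw [h]
  · exact Real.cos_two_pi_sub _

lemma sin_partner (z : Phase) : Real.sin (partner z 1) = -Real.sin (z 1) := by
  rw [partner_one]
  split_ifs with h
  · simp [h]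
  · exact Real.sin_two_pi_sub _

lemma ellipticMap_partner (z : Phase) : ellipticMap (partner z) = ellipticMap z := by
  refine phase_ext ?_ ?_ ?_ ?_ <;>
    simp only [ellipticMap_zero, ellipticMap_one, ellipticMap_two, ellipticMap_three,
      cos_partner, sin_partner, partner_zero, partner_two, partner_three, Real.cosh_neg,
      Real.sinh_neg] <;> ring

lemma partner_mem_Ico {z : Phase} (hz : z 1 ∈ Ico 0 (2 * Real.pi)) :
    partner z 1 ∈ Ico 0 (2 * Real.pi) := by
  rw [partner_one]
  obtain ⟨h0, h1⟩ := hz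
  split_ifs with h
  · exact ⟨le_rfl, by positivity⟩
  · have : 0 < z 1 := lt_of_le_of_ne h0 (Ne.symm h)
    exact ⟨by linarith, by linarith⟩

lemma partner_ne {z : Phase} (hz : z ∈ ellipticDomain) : partner z ≠ z := by
  intro h
  have h0 : z 0 = 0 := by
    have := congrArg (fun x : Phase => x 0) h
    simp only [partner_zero] at this
    linarith
  have hs : Real.sin (z 1) = 0 := by
    have := sin_partner z
    rw [h] at this
    linarith
  have hc : Real.cos (z 1) ^ 2 = 1 := by
    have := Real.sin_sq_add_cos_sq (z 1)
    rw [hs] at this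
    linarith
  exact mem_ellipticDomain.1 hz (by rw [h0, hc]; simp)

lemma eq_or_eq_of_cos_eq {s t : ℝ} (hs : s ∈ Ico 0 (2 * Real.pi)) (ht : t ∈ Ico 0 (2 * Real.pi))
    (h : Real.cos s = Real.cos t) : s = t ∨ (t ≠ 0 ∧ s = 2 * Real.pi - t) := by
  have hpi := Real.pi_pos
  obtain ⟨hs0, hs1⟩ := hs
  obtain ⟨ht0, ht1⟩ := ht
  obtain ⟨n, hn | hn⟩ := Real.cos_eq_cos_iff.1 h
  · have h1 : (n : ℝ) < 1 := by nlinarith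
    have h2 : (-1 : ℝ) < n := by nlinarith
    have h3 : n = 0 := by
      have h1' : n < 1 := by exact_mod_cast h1
      have h2' : -1 < n := by exact_mod_cast h2
      omega
    subst h3
    left
    simp at hn
    exact hn.symm
  · have h1 : (n : ℝ) < 2 := by nlinarith
    have h2 : (-1 : ℝ) < n := by nlinarith
    have h3 : n = 0 ∨ n = 1 := by
      have h1' : n < 2 := by exact_mod_cast h1
      have h2' : -1 < n := by exact_mod_cast h2
      omega
    obtain rfl | rfl := h3
    · left
      simp at hn
      linarith
    · right
      simp at hn
      constructor
      · intro h0
        linarith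
      · linarith

/-- Two points with `nu ∈ [0, 2π)` and equal images coincide or are partners. -/
lemma eq_or_eq_partner {y z : Phase} (hz : z ∈ ellipticDomain) (hy1 : y 1 ∈ Ico 0 (2 * Real.pi))
    (hz1 : z 1 ∈ Ico 0 (2 * Real.pi)) (h : ellipticMap y = ellipticMap z) :
    y = z ∨ y = partner z := by
  have hy : y ∈ ellipticDomain := by rwa [ellipticDomain, mem_preimage, h]
  have hE : Real.cosh (y 0) + Real.cos (y 1) = Real.cosh (z 0) + Real.cos (z 1) := by
    have := dist_ellipticMap_earth y
    rw [h, dist_ellipticMap_earth] at this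
    linarith
  have hM : Real.cosh (y 0) - Real.cos (y 1) = Real.cosh (z 0) - Real.cos (z 1) := by
    have := dist_ellipticMap_moon y
    rw [h, dist_ellipticMap_moon] at this
    linarith
  have hch : Real.cosh (y 0) = Real.cosh (z 0) := by linarith
  have hcs : Real.cos (y 1) = Real.cos (z 1) := by linarith
  have hy0 : y 0 = z 0 ∨ y 0 = -z 0 := abs_eq_abs.1 (le_antisymm
    (Real.cosh_le_cosh.1 hch.le) (Real.cosh_le_cosh.1 hch.ge))
  have hy1' : y 1 = z 1 ∨ y 1 = partner z 1 := by
    rw [partner_one]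
    rcases eq_or_eq_of_cos_eq hy1 hz1 hcs with h | ⟨h, h'⟩
    · exact Or.inl h
    · rw [if_neg h]
      exact Or.inr h'
  have hq : Real.sinh (y 0) * Real.sin (y 1) = Real.sinh (z 0) * Real.sin (z 1) := by
    have := congrArg (fun x : Phase => x 1) h
    simp only [ellipticMap_one] at this
    linarith
  -- The momenta are determined by the position and the Cartesian momenta.
  have hmom : ∀ w, w ∈ ellipticDomain → ellipticMap w = ellipticMap y → y 0 = w 0 →
      y 1 = w 1 → y = w := by
    intro w hw hwy e0 e1
    obtain ⟨a2, a3⟩ := momentum_eq hy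
    obtain ⟨b2, b3⟩ := momentum_eq hw
    refine phase_ext e0 e1 ?_ ?_
    · rw [a2, b2, hwy, e0, e1]
    · rw [a3, b3, hwy, e0, e1]
  have hzp : partner z ∈ ellipticDomain := by
    rwa [ellipticDomain, mem_preimage, ellipticMap_partner]
  have key : (y 0 = z 0 ∧ y 1 = z 1) ∨ (y 0 = -z 0 ∧ y 1 = partner z 1) := by
    have mixed : Real.sinh (z 0) * Real.sin (z 1) = 0 → z 0 = 0 ∨ z 1 = partner z 1 := by
      intro h0
      rcases mul_eq_zero.1 h0 with h0 | h0
      · exact Or.inl (Real.sinh_eq_zero.1 h0)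
      · right
        have hc1 : Real.cos (z 1) = Real.cos (partner z 1) := (cos_partner z).symm
        rw [partner_one]
        split_ifs with hz0
        · exact hz0
        · obtain ⟨n, hn⟩ := Real.sin_eq_zero_iff.1 h0
          have hpi := Real.pi_pos
          have hz0' : 0 < z 1 := lt_of_le_of_ne hz1.1 (Ne.symm hz0)
          have hn0 : (0 : ℝ) < n := by
            by_contra hneg
            push Not at hneg
            nlinarith
          have hn2 : (n : ℝ) < 2 := by
            have := hz1.2
            by_contra hneg
            push Not at hneg
            nlinarith
          have : n = 1 := by
            have h1 : 0 < n := by exact_mod_cast hn0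
            have h2 : n < 2 := by exact_mod_cast hn2
            omega
          rw [this] at hn
          push_cast at hn
          linarith
    rcases hy0 with e0 | e0 <;> rcases hy1' with e1 | e1
    · exact Or.inl ⟨e0, e1⟩
    · rw [e0, e1, sin_partner] at hq
      rcases mixed (by linarith) with h0 | h0
      · right
        rw [e0, e1, h0]
        simp
      · left
        exact ⟨e0, e1.trans h0.symm⟩
    · rw [e0, e1, Real.sinh_neg] at hq
      rcases mixed (by linarith) with h0 | h0
      · left
        rw [e0, e1, h0]
        simp
      · right
        exact ⟨e0, e1.trans h0⟩
    · exact Or.inr ⟨e0, e1⟩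
  rcases key with ⟨e0, e1⟩ | ⟨e0, e1⟩
  · exact Or.inl (hmom z hz h.symm e0 e1)
  · exact Or.inr (hmom _ hzp ((ellipticMap_partner z).trans h.symm) (by simpa using e0) e1)

lemma exists_ellipticMap_eq {x : Phase} (hx : x ∈ phaseSpace) :
    ∃ z : Phase, z 1 ∈ Ico 0 (2 * Real.pi) ∧ ellipticMap z = x := by
  set d₁ := dist (position x) earth with hd₁
  set d₂ := dist (position x) moon with hd₂
  have s₁ : d₁ ^ 2 = (x 0 + 1 / 2) ^ 2 + x 1 ^ 2 := by
    rw [hd₁, dist_earth, Real.sq_sqrt (by positivity)]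
  have s₂ : d₂ ^ 2 = (x 0 - 1 / 2) ^ 2 + x 1 ^ 2 := by
    rw [hd₂, dist_moon, Real.sq_sqrt (by positivity)]
  have hEM := dist_earth_moon
  have p₁ : 0 ≤ d₁ := dist_nonneg
  have p₂ : 0 ≤ d₂ := dist_nonneg
  have hX : 1 ≤ d₁ + d₂ := by
    have := dist_triangle earth (position x) moon
    rwa [hEM, dist_comm earth] at this
  have hY₁ : d₁ - d₂ ≤ 1 := by
    have := dist_triangle (position x) moon earth
    rw [dist_comm moon earth, hEM] at this
    linarith
  have hY₂ : -1 ≤ d₁ - d₂ := by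
    have := dist_triangle (position x) earth moon
    rw [hEM] at this
    linarith
  have hx0 : x 0 = (d₁ + d₂) * (d₁ - d₂) / 2 := by nlinarith
  have hsq : ((d₁ + d₂) ^ 2 - 1) * (1 - (d₁ - d₂) ^ 2) = (2 * x 1) ^ 2 := by
    have e : (d₁ + d₂) ^ 2 + (d₁ - d₂) ^ 2 = 2 * (d₁ ^ 2 + d₂ ^ 2) := by ring
    have e' : (d₁ + d₂) ^ 2 * (d₁ - d₂) ^ 2 = (d₁ ^ 2 - d₂ ^ 2) ^ 2 := by ring
    have : ((d₁ + d₂) ^ 2 - 1) * (1 - (d₁ - d₂) ^ 2)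
        = ((d₁ + d₂) ^ 2 + (d₁ - d₂) ^ 2) - (d₁ + d₂) ^ 2 * (d₁ - d₂) ^ 2 - 1 := by ring
    rw [this, e, e', s₁, s₂]
    ring
  obtain ⟨a, b, hb, ha, hcos, hsin⟩ : ∃ a b : ℝ, b ∈ Icc 0 Real.pi ∧ Real.cosh a = d₁ + d₂ ∧
      Real.cos b = d₁ - d₂ ∧ Real.sinh a * Real.sin b = 2 * x 1 := by
    have hc := Real.cos_arccos hY₂ hY₁
    have hb : Real.arccos (d₁ - d₂) ∈ Icc 0 Real.pi := ⟨Real.arccos_nonneg _, Real.arccos_le_pi _⟩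
    have hch := Real.cosh_arcosh hX
    have hprod : (Real.sinh (Real.arcosh (d₁ + d₂)) * Real.sin (Real.arccos (d₁ - d₂))) ^ 2
        = (2 * x 1) ^ 2 := by
      rw [mul_pow, Real.sinh_sq, Real.sin_sq, hc, hch, hsq]
    rcases sq_eq_sq_iff_eq_or_eq_neg.1 hprod with h | h
    · exact ⟨_, _, hb, hch, hc, h⟩
    · refine ⟨-Real.arcosh (d₁ + d₂), _, hb, by rw [Real.cosh_neg, hch], hc, ?_⟩
      rw [Real.sinh_neg]
      linarith
  refine ⟨!₂[a, b, (x 2 * (Real.sinh a * Real.cos b) + x 3 * (Real.cosh a * Real.sin b)) / 2,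
    (-x 2 * (Real.cosh a * Real.sin b) + x 3 * (Real.sinh a * Real.cos b)) / 2], ?_, ?_⟩
  · have := Real.pi_pos
    simp only [Matrix.cons_val_one, Matrix.cons_val_zero]
    exact ⟨hb.1, by linarith [hb.2]⟩
  · rw [ellipticMap_eq_iff]
    · simp
      refine ⟨?_, ?_⟩
      · rw [ha, hcos, hx0]
      · rw [hsin]
        ring
    · obtain ⟨h1, h2⟩ := mem_phaseSpace_iff_dist.1 hx
      have : Real.cosh a ^ 2 - Real.cos b ^ 2 = 4 * (d₁ * d₂) := by
        rw [ha, hcos]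
        ring
      simpa [this] using ⟨h1, h2⟩

lemma ncard_fibre {x : Phase} (hx : x ∈ phaseSpace) :
    {z : Phase | z 1 ∈ Ico 0 (2 * Real.pi) ∧ ellipticMap z = x}.ncard = 2 := by
  obtain ⟨z, hz1, rfl⟩ := exists_ellipticMap_eq hx
  have hz : z ∈ ellipticDomain := hx
  rw [show {y : Phase | y 1 ∈ Ico 0 (2 * Real.pi) ∧ ellipticMap y = ellipticMap z}
    = {z, partner z} from ?_, ncard_pair (partner_ne hz).symm]
  ext y
  simp only [mem_ofPred_eq, mem_insert_iff, mem_singleton_iff]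
  constructor
  · rintro ⟨hy1, hy⟩
    exact eq_or_eq_partner hz hy1 hz1 hy
  · rintro (rfl | rfl)
    · exact ⟨hz1, rfl⟩
    · exact ⟨partner_mem_Ico hz1, ellipticMap_partner z⟩

/-! ### Star bodies -/

section StarBody

variable {E : Type*} [NormedAddCommGroup E] [NormedSpace ℝ E]

/-- `K` is a compact body, strictly star-shaped about `o`, and `O` is an open subset of `K` that
contains all points of `K` after any contraction towards `o`. The hypersurface bounding the body is
`K \ O`. -/
structure IsStarBody (o : E) (K O : Set E) : Prop where
  isCompact : IsCompact K
  isOpen : IsOpen O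
  center_mem : o ∈ O
  subset : O ⊆ K
  contract : ∀ z ∈ K, ∀ s ∈ Ico (0 : ℝ) 1, o + s • (z - o) ∈ O

/-- The parameter at which the ray from `o` in the direction `u` leaves `K`. -/
def exitTime (o : E) (K : Set E) (u : E) : ℝ := sSup {s : ℝ | 0 ≤ s ∧ o + s • u ∈ K}

namespace IsStarBody

variable {o : E} {K O : Set E} (h : IsStarBody o K O) {u : E} {s t : ℝ}
include h

lemma mem_of_lt (hs : 0 ≤ s) (hst : s < t) (ht : o + t • u ∈ K) : o + s • u ∈ O := by
  have ht0 : 0 < t := hs.trans_lt hst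
  have := h.contract _ ht (s / t) ⟨by positivity, (div_lt_one ht0).2 hst⟩
  rwa [add_sub_cancel_left, smul_smul, div_mul_cancel₀ _ ht0.ne'] at this

lemma bddAbove (hu : u ≠ 0) : BddAbove {s : ℝ | 0 ≤ s ∧ o + s • u ∈ K} := by
  obtain ⟨R, hR⟩ := h.isCompact.isBounded.exists_norm_le
  refine ⟨(R + ‖o‖) / ‖u‖, fun s hs => ?_⟩
  rw [le_div_iff₀ (norm_pos_iff.2 hu)]
  have h1 : ‖s • u‖ ≤ ‖o + s • u‖ + ‖o‖ := by
    have := norm_sub_le (o + s • u) o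
    rwa [add_sub_cancel_left] at this
  rw [norm_smul, Real.norm_of_nonneg hs.1] at h1
  linarith [hR _ hs.2]

lemma le_exitTime (hu : u ≠ 0) (hs : 0 ≤ s) (hm : o + s • u ∈ K) : s ≤ exitTime o K u :=
  le_csSup (h.bddAbove hu) ⟨hs, hm⟩

lemma exitTime_mem (hu : u ≠ 0) : 0 ≤ exitTime o K u ∧ o + exitTime o K u • u ∈ K := by
  have hcl : IsClosed {s : ℝ | 0 ≤ s ∧ o + s • u ∈ K} :=
    (isClosed_le continuous_const continuous_id).inter
      (h.isCompact.isClosed.preimage (by fun_prop : Continuous fun s : ℝ => o + s • u))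
  exact hcl.csSup_mem ⟨0, le_rfl, by simpa using h.subset h.center_mem⟩ (h.bddAbove hu)

lemma lt_exitTime (hu : u ≠ 0) (hs : 0 ≤ s) (hm : o + s • u ∈ O) : s < exitTime o K u := by
  have hc : Continuous fun s : ℝ => o + s • u := by fun_prop
  have hev : ∀ᶠ t in nhdsWithin s (Ioi s), o + t • u ∈ O :=
    (hc.continuousAt.eventually_mem (h.isOpen.mem_nhds hm)).filter_mono nhdsWithin_le_nhds
  obtain ⟨t, ht, hst⟩ := (hev.and self_mem_nhdsWithin).exists
  exact lt_of_lt_of_le hst (h.le_exitTime hu (hs.trans (le_of_lt hst)) (h.subset ht))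

lemma exitTime_pos (hu : u ≠ 0) : 0 < exitTime o K u :=
  h.lt_exitTime hu le_rfl (by simpa using h.center_mem)

lemma mem_of_lt_exitTime (hu : u ≠ 0) (hs : 0 ≤ s) (hlt : s < exitTime o K u) :
    o + s • u ∈ O :=
  h.mem_of_lt hs hlt (h.exitTime_mem hu).2

lemma exit_mem_diff (hu : u ≠ 0) : o + exitTime o K u • u ∈ K \ O :=
  ⟨(h.exitTime_mem hu).2, fun hO => lt_irrefl _ (h.lt_exitTime hu (h.exitTime_mem hu).1 hO)⟩

lemma exitTime_eq_one {z : E} (hz : z ∈ K \ O) : exitTime o K (z - o) = 1 := by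
  have hu : z - o ≠ 0 := fun hzo => hz.2 (by rw [sub_eq_zero.1 hzo]; exact h.center_mem)
  have hz' : o + (1 : ℝ) • (z - o) = z := by simp
  refine le_antisymm ?_ (h.le_exitTime hu zero_le_one (by rw [hz']; exact hz.1))
  by_contra hlt
  push Not at hlt
  have := h.mem_of_lt_exitTime hu zero_le_one hlt
  rw [hz'] at this
  exact hz.2 this

lemma continuousAt_exitTime (hu : u ≠ 0) : ContinuousAt (exitTime o K) u := by
  have hne : ∀ᶠ v in nhds u, v ≠ (0 : E) := isOpen_ne.mem_nhds hu
  have hc : ∀ s : ℝ, Continuous fun v : E => o + s • v := fun s => by fun_prop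
  refine tendsto_order.2 ⟨fun a ha => ?_, fun a ha => ?_⟩
  · have hm := h.mem_of_lt_exitTime hu (le_max_right a 0) (max_lt ha (h.exitTime_pos hu))
    filter_upwards [hne, (hc (max a 0)).continuousAt.eventually_mem (h.isOpen.mem_nhds hm)]
      with v hv hvO
    exact (le_max_left a 0).trans_lt (h.lt_exitTime hv (le_max_right a 0) hvO)
  · have ha0 : 0 ≤ a := (h.exitTime_pos hu).le.trans ha.le
    have hm : o + a • u ∈ Kᶜ := fun hK => absurd (h.le_exitTime hu ha0 hK) (not_le.2 ha)
    filter_upwards [hne, (hc a).continuousAt.eventually_mem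
      (h.isCompact.isClosed.isOpen_compl.mem_nhds hm)] with v hv hvK
    by_contra hle
    push Not at hle
    rcases hle.lt_or_eq with hlt | heq
    · exact hvK (h.subset (h.mem_of_lt_exitTime hv ha0 hlt))
    · exact hvK (heq ▸ (h.exitTime_mem hv).2)

lemma interior_eq : interior K = O := by
  refine subset_antisymm (fun z hz => ?_) (interior_maximal h.subset h.isOpen)
  have hc : Continuous fun s : ℝ => o + s • (z - o) := by fun_prop
  have hev : ∀ᶠ s in nhdsWithin (1 : ℝ) (Ioi 1), o + s • (z - o) ∈ interior K :=
    nhdsWithin_le_nhds (hc.continuousAt.eventually_mem (isOpen_interior.mem_nhds (by simpa)))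
  obtain ⟨s, hs, hs1⟩ := (hev.and self_mem_nhdsWithin).exists
  simpa using h.mem_of_lt zero_le_one hs1 (interior_subset hs)

lemma frontier_eq : frontier K = K \ O := by
  rw [h.isCompact.isClosed.frontier_eq, h.interior_eq]

/-- The radial projection from `o` onto the bounding hypersurface is continuous. -/
lemma continuousOn_exit {N : Set E} (hN : (0 : E) ∉ N) :
    ContinuousOn (fun u => o + exitTime o K u • u) N := fun u hu => by
  have hu0 : u ≠ 0 := fun h0 => hN (h0 ▸ hu)
  exact (continuousAt_const.add
    ((h.continuousAt_exitTime hu0).smul continuousAt_id)).continuousWithinAt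

/-- The part of the bounding hypersurface in a cone `N` is the radial projection of `N`. -/
lemma image_exit {N : Set E} (hN : (0 : E) ∉ N) (hcone : ∀ u ∈ N, ∀ t : ℝ, 0 < t → t • u ∈ N) :
    (fun u => o + exitTime o K u • u) '' N = {z ∈ K \ O | z - o ∈ N} := by
  ext z
  constructor
  · rintro ⟨u, hu, rfl⟩
    have hu0 : u ≠ 0 := fun h0 => hN (h0 ▸ hu)
    exact ⟨h.exit_mem_diff hu0, by simpa using hcone u hu _ (h.exitTime_pos hu0)⟩
  · rintro ⟨hz, hzN⟩
    exact ⟨z - o, hzN, by simp [h.exitTime_eq_one hz]⟩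

lemma diff_subset_closure {N : Set E} (hN : (0 : E) ∉ N)
    (hcone : ∀ u ∈ N, ∀ t : ℝ, 0 < t → t • u ∈ N) (hd : Dense N) :
    K \ O ⊆ closure {z ∈ K \ O | z - o ∈ N} := by
  intro z hz
  have hu : z - o ≠ 0 := fun hzo => hz.2 (by rw [sub_eq_zero.1 hzo]; exact h.center_mem)
  rw [← h.image_exit hN hcone]
  have hc : ContinuousAt (fun u => o + exitTime o K u • u) (z - o) :=
    continuousAt_const.add ((h.continuousAt_exitTime hu).smul continuousAt_id)
  have := hc.continuousWithinAt.mem_closure_image (hd (z - o))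
  simpa [h.exitTime_eq_one hz] using this

/-- A strictly star-shaped body is strictly convex as soon as every segment inside the body avoids
the bounding hypersurface, except possibly at its endpoints. Given two points of the body, the
segment between them is contracted to `o`; the largest contraction that lies in the body touches
the bounding hypersurface unless it is the segment itself. -/
lemma strictConvex
    (hseg : ∀ x y : E, x ≠ y → (∀ t ∈ Icc (0 : ℝ) 1, x + t • (y - x) ∈ K) →
      ∀ t ∈ Ioo (0 : ℝ) 1, x + t • (y - x) ∈ O) : StrictConvex ℝ K := by
  have hsub : ∀ x ∈ K, ∀ y ∈ K, ∀ t ∈ Icc (0 : ℝ) 1, x + t • (y - x) ∈ K := by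
    intro x hx y hy
    by_cases hxy : x = y
    · subst hxy
      intro t _
      simpa using hx
    -- `f s t` is the point with parameter `t` on the segment contracted by the factor `s`.
    set f : ℝ → ℝ → E := fun s t => o + s • (x + t • (y - x) - o) with hf
    have hfc : Continuous fun p : ℝ × ℝ => f p.1 p.2 := by
      simp only [hf]
      fun_prop
    have hfline : ∀ s t, f s t = f s 0 + t • (f s 1 - f s 0) := by
      intro s t
      simp only [hf]
      module
    set G : Set ℝ := {s | s ∈ Icc (0 : ℝ) 1 ∧ ∀ t ∈ Icc (0 : ℝ) 1, f s t ∈ K} with hG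
    have hGcl : IsClosed G := by
      have : G = Icc 0 1 ∩ ⋂ t ∈ Icc (0 : ℝ) 1, (fun s => f s t) ⁻¹' K := by
        ext s
        simp [hG]
      rw [this]
      refine isClosed_Icc.inter (isClosed_biInter fun t _ => h.isCompact.isClosed.preimage ?_)
      simp only [hf]
      fun_prop
    have hGc : IsCompact G := isCompact_Icc.of_isClosed_subset hGcl fun s hs => hs.1
    have hG0 : (0 : ℝ) ∈ G :=
      ⟨⟨le_rfl, zero_le_one⟩, fun t _ => by simpa [hf] using h.subset h.center_mem⟩
    obtain ⟨s, hsG, hmax⟩ := hGc.exists_isGreatest ⟨0, hG0⟩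
    have hs1 : s = 1 := by
      by_contra hne
      have hlt : s < 1 := lt_of_le_of_ne hsG.1.2 hne
      have hO : ∀ t ∈ Icc (0 : ℝ) 1, f s t ∈ O := by
        by_cases hs0 : s = 0
        · intro t _
          simpa [hf, hs0] using h.center_mem
        have hends : f s 0 ≠ f s 1 := by
          intro he
          have e : f s 1 - f s 0 = s • (y - x) := by
            simp only [hf]
            module
          rw [he, sub_self] at e
          rcases smul_eq_zero.1 e.symm with h' | h'
          · exact hs0 h'
          · exact hxy (sub_eq_zero.1 h').symm
        intro t ht
        rcases ht.1.eq_or_lt with rfl | ht0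
        · simpa [hf] using h.contract x hx s ⟨hsG.1.1, hlt⟩
        rcases ht.2.eq_or_lt with rfl | ht1
        · simpa [hf] using h.contract y hy s ⟨hsG.1.1, hlt⟩
        rw [hfline]
        refine hseg _ _ hends (fun t ht => ?_) t ⟨ht0, ht1⟩
        rw [← hfline]
        exact hsG.2 t ht
      obtain ⟨U, V, hU, -, hsU, hIV, hUV⟩ := generalized_tube_lemma (isCompact_singleton (x := s))
        (isCompact_Icc (a := (0 : ℝ)) (b := 1)) (h.isOpen.preimage hfc) (by
          rintro ⟨a, b⟩ ⟨ha, hb⟩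
          obtain rfl : a = s := ha
          exact hO b hb)
      have hev : ∀ᶠ s' in nhdsWithin s (Ioi s), s' ∈ U :=
        
        nhdsWithin_le_nhds (hU.mem_nhds (hsU rfl))
      have hev' : ∀ᶠ s' in nhdsWithin s (Ioi s), s' < 1 :=
        
        nhdsWithin_le_nhds (isOpen_Iio.mem_nhds hlt)
      obtain ⟨s', ⟨hs'U, hs'1⟩, hss'⟩ := ((hev.and hev').and self_mem_nhdsWithin).exists
      have : s' ∈ G := ⟨⟨hsG.1.1.trans (le_of_lt hss'), hs'1.le⟩,
        fun t ht => h.subset (hUV (mk_mem_prod hs'U (hIV ht)))⟩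
      exact absurd (hmax this) (not_le.2 hss')
    intro t ht
    have := hsG.2 t ht
    rw [hs1] at this
    simpa [hf] using this
  intro x hx y hy hxy a b ha hb hab
  have := hseg x y hxy (hsub x hx y hy) b ⟨hb, by linarith⟩
  refine interior_maximal h.subset h.isOpen ?_
  convert! this using 1
  rw [← sub_eq_iff_eq_add.2 hab.symm]
  module

end IsStarBody

end StarBody

/-! ### A second derivative test -/

/-- A critical point with positive second derivative is a strict local minimum. -/
lemma eventually_gt_of_deriv2_pos {f f' : ℝ → ℝ} {f'' t : ℝ}
    (hf : ∀ s, HasDerivAt f (f' s) s) (h0 : f' t = 0) (hf' : HasDerivAt f' f'' t)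
    (hpos : 0 < f'') : ∀ᶠ s in nhdsWithin t {t}ᶜ, f t < f s := by
  have hsq : ∀ s, HasDerivAt (fun s => f'' / 4 * (s - t) ^ 2) (f'' / 2 * (s - t)) s := by
    intro s
    refine ((((hasDerivAt_id s).sub_const t).pow 2).const_mul (f'' / 4)).congr_deriv ?_
    simp
    ring
  have hg : ∀ s, HasDerivAt (fun s => f s - f'' / 4 * (s - t) ^ 2) (f' s - f'' / 2 * (s - t)) s :=
    fun s => (hf s).sub (hsq s)
  have hg' : deriv (fun s => f s - f'' / 4 * (s - t) ^ 2) = fun s => f' s - f'' / 2 * (s - t) :=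
    funext fun s => (hg s).deriv
  have hg'' : HasDerivAt (fun s => f' s - f'' / 2 * (s - t)) (f'' / 2) t := by
    refine (hf'.sub (((hasDerivAt_id t).sub_const t).const_mul (f'' / 2))).congr_deriv ?_
    ring
  have hmin := isLocalMin_of_deriv_deriv_pos (f := fun s => f s - f'' / 4 * (s - t) ^ 2) (x₀ := t)
    (by rw [hg', hg''.deriv]; positivity) (by rw [hg']; simp [h0]) (hg t).continuousAt
  filter_upwards [nhdsWithin_le_nhds hmin, self_mem_nhdsWithin] with s hs hst
  have hne : s - t ≠ 0 := sub_ne_zero.2 hst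
  have : 0 < f'' / 4 * (s - t) ^ 2 := by positivity
  simp only [sub_self] at hs
  linarith

/-! ### The separated regularized Hamiltonian -/

/-- The part of the regularized Hamiltonian depending on `lam`, with `k = -c`. -/
def lamPot (k a : ℝ) : ℝ := k * Real.cosh a ^ 2 - 2 * Real.cosh a

/-- The part of the regularized Hamiltonian depending on `nu`, with `m = 1 - 2μ` and `k = -c`. -/
def nuPot (m k b : ℝ) : ℝ := 2 * m * Real.cos b - k * Real.cos b ^ 2

/-- The regularized Hamiltonian in terms of `m = 1 - 2μ` and `k = -c`. -/
def regEnergy (m k : ℝ) (z : Phase) : ℝ :=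
  lamPot k (z 0) + nuPot m k (z 1) + 2 * z 2 ^ 2 + 2 * z 3 ^ 2

lemma regHamiltonian_eq (μ c : ℝ) : regHamiltonian μ c = regEnergy (1 - 2 * μ) (-c) := by
  funext z
  simp only [regHamiltonian, Q1, Q2, regEnergy, lamPot, nuPot]
  ring

/-- The range of the parameters `m = 1 - 2μ` and `k = -c` for `0 < μ < 1` and `c < c_J`. -/
structure Subcritical (m k : ℝ) : Prop where
  neg_one_lt : -1 < m
  lt_one : m < 1
  one_lt : 1 < k
  pos : 0 < k ^ 2 - 2 * k + m ^ 2

lemma criticalEnergy_eq {μ : ℝ} (h0 : 0 < μ) (h1 : μ < 1) :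
    criticalEnergy μ = -1 - 2 * √(μ * (1 - μ)) := by
  have hA : 0 < √(1 - μ) := Real.sqrt_pos.2 (by linarith)
  have hB : 0 < √μ := Real.sqrt_pos.2 h0
  have hA2 : √(1 - μ) ^ 2 = 1 - μ := Real.sq_sqrt (by linarith)
  have hB2 : √μ ^ 2 = μ := Real.sq_sqrt h0.le
  have hAB : √(μ * (1 - μ)) = √μ * √(1 - μ) := Real.sqrt_mul h0.le _
  set A := √(1 - μ)
  set B := √μ
  have hl : lagrangeDist μ = A / (A + B) := by
    unfold lagrangeDist
    split_ifs with h
    · have : A = B := by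
        have : A ^ 2 = B ^ 2 := by rw [hA2, hB2, h]; norm_num
        exact (sq_eq_sq₀ hA.le hB.le).1 this
      rw [this]
      field_simp
      norm_num
    · have hne : 1 - 2 * μ ≠ 0 := fun h' => h (by linarith)
      rw [hAB, div_eq_div_iff hne (by positivity), ← hA2,
        show 1 - 2 * μ = A ^ 2 - B ^ 2 by rw [hA2, hB2]; ring]
      ring
  have hd₁ : dist (position (lagrangePoint μ)) earth = A / (A + B) := by
    rw [dist_earth]
    simp only [lagrangePoint, hl]
    simp only [Matrix.cons_val_zero, Matrix.cons_val_one]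
    rw [show (A / (A + B) - 1 / 2 + 1 / 2) ^ 2 + (0 : ℝ) ^ 2 = (A / (A + B)) ^ 2 by ring,
      Real.sqrt_sq (by positivity)]
  have hd₂ : dist (position (lagrangePoint μ)) moon = B / (A + B) := by
    rw [dist_moon]
    simp only [lagrangePoint, hl]
    simp only [Matrix.cons_val_zero, Matrix.cons_val_one]
    rw [show (A / (A + B) - 1 / 2 - 1 / 2) ^ 2 + (0 : ℝ) ^ 2 = (B / (A + B)) ^ 2 by
      field_simp; ring, Real.sqrt_sq (by positivity)]
  rw [criticalEnergy, hamiltonian, potential, hd₁, hd₂, hAB, ← hA2,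
    show -A ^ 2 / (A / (A + B)) - μ / (B / (A + B)) = -(A + B) ^ 2 by
      rw [← hB2]; field_simp; ring]
  simp only [lagrangePoint]
  simp
  nlinarith

lemma subcritical_of_lt {μ c : ℝ} (h0 : 0 < μ) (h1 : μ < 1) (hc : c < criticalEnergy μ) :
    Subcritical (1 - 2 * μ) (-c) := by
  rw [criticalEnergy_eq h0 h1] at hc
  have hs : √(μ * (1 - μ)) ^ 2 = μ * (1 - μ) := Real.sq_sqrt (by nlinarith)
  have hs0 : 0 ≤ √(μ * (1 - μ)) := Real.sqrt_nonneg _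
  refine ⟨by linarith, by linarith, by linarith, ?_⟩
  nlinarith

lemma lt_criticalEnergy {μ k : ℝ} (h0 : 0 < μ) (h1 : μ < 1) (hk : Subcritical (1 - 2 * μ) k) :
    -k < criticalEnergy μ := by
  rw [criticalEnergy_eq h0 h1]
  have hs : √(μ * (1 - μ)) ^ 2 = μ * (1 - μ) := Real.sq_sqrt (by nlinarith)
  have hs0 : 0 ≤ √(μ * (1 - μ)) := Real.sqrt_nonneg _
  have := hk.pos
  have := hk.one_lt
  nlinarith

lemma regEnergy_eq_hamiltonian {μ c : ℝ} {z : Phase} (hz : z ∈ ellipticDomain) :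
    regEnergy (1 - 2 * μ) (-c) z =
      (hamiltonian μ (ellipticMap z) - c) * (Real.cosh (z 0) ^ 2 - Real.cos (z 1) ^ 2) := by
  have hd := mem_ellipticDomain.1 hz
  have hd' : Real.cosh (z 0) ^ 2 - Real.cos (z 1) ^ 2
      = (Real.cosh (z 0) + Real.cos (z 1)) * (Real.cosh (z 0) - Real.cos (z 1)) := by ring
  have hp := left_ne_zero_of_mul (hd' ▸ hd)
  have hm := right_ne_zero_of_mul (hd' ▸ hd)
  have hkin : (ellipticMap z 2 ^ 2 + ellipticMap z 3 ^ 2) / 2 *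
      (Real.cosh (z 0) ^ 2 - Real.cos (z 1) ^ 2) = 2 * z 2 ^ 2 + 2 * z 3 ^ 2 := by
    obtain ⟨h2, h3⟩ := momentum_eq hz
    rw [← sq_add_sq_eq_cosh_sq_sub_cos_sq, h2, h3]
    ring
  have hpot : potential μ (position (ellipticMap z)) *
      (Real.cosh (z 0) ^ 2 - Real.cos (z 1) ^ 2)
        = -2 * Real.cosh (z 0) + 2 * (1 - 2 * μ) * Real.cos (z 1) := by
    rw [potential, dist_ellipticMap_earth, dist_ellipticMap_moon, hd']
    field_simp
    ring
  rw [hamiltonian, sub_mul, add_mul, hkin, hpot, regEnergy, lamPot, nuPot]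
  ring

/-- A bound for the first potential, attained at `lam = 0` only. -/
lemma lamPot_zero_le {k : ℝ} (hk : 1 < k) (a : ℝ) : k - 2 ≤ lamPot k a := by
  have := Real.one_le_cosh a
  unfold lamPot
  nlinarith [mul_nonneg (sub_nonneg.2 this) (by nlinarith : 0 ≤ k * (Real.cosh a + 1) - 2)]

lemma lamPot_mono {k a a' : ℝ} (hk : 1 < k) (h : |a| ≤ |a'|) : lamPot k a ≤ lamPot k a' := by
  have h1 := Real.one_le_cosh a
  have h2 := Real.cosh_le_cosh.2 h
  unfold lamPot
  nlinarith [mul_nonneg (sub_nonneg.2 h2) (by nlinarith :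
    0 ≤ k * (Real.cosh a + Real.cosh a') - 2)]

lemma lamPot_strictMono {k a a' : ℝ} (hk : 1 < k) (h : |a| < |a'|) :
    lamPot k a < lamPot k a' := by
  have h1 := Real.one_le_cosh a
  have h2 := Real.cosh_lt_cosh.2 h
  unfold lamPot
  nlinarith [mul_pos (sub_pos.2 h2) (by nlinarith :
    0 < k * (Real.cosh a + Real.cosh a') - 2)]

/-- In terms of `y = cos nu`, the second potential increases up to the saddle at `y = m / k`. -/
lemma nuPot_mono {m k b b' : ℝ} (hk : 1 < k) (h : Real.cos b ≤ Real.cos b')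
    (hb' : Real.cos b' ≤ m / k) : nuPot m k b ≤ nuPot m k b' := by
  rw [le_div_iff₀ (by linarith)] at hb'
  unfold nuPot
  nlinarith [mul_nonneg (sub_nonneg.2 h) (by nlinarith :
    0 ≤ 2 * m - k * (Real.cos b + Real.cos b'))]

lemma nuPot_strictMono {m k b b' : ℝ} (hk : 1 < k) (h : Real.cos b < Real.cos b')
    (hb' : Real.cos b' ≤ m / k) : nuPot m k b < nuPot m k b' := by
  rw [le_div_iff₀ (by linarith)] at hb'
  unfold nuPot
  nlinarith [mul_pos (sub_pos.2 h) (by nlinarith :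
    0 < 2 * m - k * (Real.cos b + Real.cos b'))]

/-- Below the critical energy there are no states over the line through the saddle. -/
lemma cos_ne_of_regEnergy_nonpos {m k : ℝ} (hk : Subcritical m k) {z : Phase}
    (hz : regEnergy m k z ≤ 0) : Real.cos (z 1) ≠ m / k := by
  intro h
  have hk0 : 0 < k := by linarith [hk.one_lt]
  have h1 := lamPot_zero_le hk.one_lt (z 0)
  have h2 : nuPot m k (z 1) = m ^ 2 / k := by
    rw [nuPot, h]
    field_simp
    ring
  have h3 : k - 2 + m ^ 2 / k = (k ^ 2 - 2 * k + m ^ 2) / k := by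
    field_simp
  have h4 : 0 < (k ^ 2 - 2 * k + m ^ 2) / k := div_pos hk.pos hk0
  unfold regEnergy at hz
  nlinarith [sq_nonneg (z 2), sq_nonneg (z 3)]

lemma continuous_regEnergy (m k : ℝ) : Continuous (regEnergy m k) := by
  unfold regEnergy lamPot nuPot
  fun_prop

/-! ### The well around the Earth -/

/-- The centre of the well: the lift of the Earth, with zero momenta. -/
def wellCenter : Phase := !₂[0, Real.pi, 0, 0]

/-- The compact body bounded by the regularized Earth component: the part of the sublevel set on
the Earth side of the saddle, over the strip `nu ∈ [0, 2π]`. -/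
def wellBody (m k : ℝ) : Set Phase :=
  {z | z 1 ∈ Icc 0 (2 * Real.pi) ∧ Real.cos (z 1) ≤ m / k ∧ regEnergy m k z ≤ 0}

/-- The interior of `wellBody`. -/
def wellInterior (m k : ℝ) : Set Phase :=
  {z | z 1 ∈ Ioo 0 (2 * Real.pi) ∧ Real.cos (z 1) < m / k ∧ regEnergy m k z < 0}

/-- The hypersurface bounding `wellBody`; it is the regularized Earth component. -/
def wellSurface (m k : ℝ) : Set Phase :=
  {z | z 1 ∈ Ioo 0 (2 * Real.pi) ∧ Real.cos (z 1) < m / k ∧ regEnergy m k z = 0}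

@[simp] lemma wellCenter_zero : wellCenter 0 = 0 := by simp [wellCenter]
@[simp] lemma wellCenter_one : wellCenter 1 = Real.pi := by simp [wellCenter]
@[simp] lemma wellCenter_two : wellCenter 2 = 0 := by simp [wellCenter]
@[simp] lemma wellCenter_three : wellCenter 3 = 0 := by simp [wellCenter]

section Well

variable {m k : ℝ} (hk : Subcritical m k)
include hk

lemma Subcritical.saddle_lt_one : m / k < 1 := by
  rw [div_lt_one (by linarith [hk.one_lt])]
  linarith [hk.one_lt, hk.lt_one]

lemma Subcritical.neg_one_lt_saddle : -1 < m / k := by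
  rw [lt_div_iff₀ (by linarith [hk.one_lt])]
  linarith [hk.one_lt, hk.neg_one_lt]

lemma mem_Ioo_of_cos_le {b : ℝ} (hb : b ∈ Icc 0 (2 * Real.pi)) (hc : Real.cos b ≤ m / k) :
    b ∈ Ioo 0 (2 * Real.pi) := by
  have h1 := hk.saddle_lt_one
  refine ⟨lt_of_le_of_ne hb.1 ?_, lt_of_le_of_ne hb.2 ?_⟩
  · rintro rfl
    rw [Real.cos_zero] at hc
    linarith
  · rintro rfl
    rw [Real.cos_two_pi] at hc
    linarith

lemma wellBody_diff_wellInterior : wellBody m k \ wellInterior m k = wellSurface m k := by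
  ext z
  constructor
  · rintro ⟨⟨h1, h2, h3⟩, h4⟩
    have h1' := mem_Ioo_of_cos_le hk h1 h2
    have h2' := lt_of_le_of_ne h2 (cos_ne_of_regEnergy_nonpos hk h3)
    refine ⟨h1', h2', le_antisymm h3 ?_⟩
    by_contra hlt
    exact h4 ⟨h1', h2', not_le.1 hlt⟩
  · rintro ⟨h1, h2, h3⟩
    exact ⟨⟨Ioo_subset_Icc_self h1, h2.le, h3.le⟩, fun h => h.2.2.ne h3⟩

lemma regEnergy_wellCenter : regEnergy m k wellCenter < 0 := by
  simp only [regEnergy, lamPot, nuPot, wellCenter_zero, wellCenter_one, wellCenter_two,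
    wellCenter_three, Real.cosh_zero, Real.cos_pi]
  linarith [hk.neg_one_lt]

lemma abs_le_of_mem_wellBody {z : Phase} (hz : z ∈ wellBody m k) (i : Fin 4) : |z i| ≤ 7 := by
  obtain ⟨h1, h2, h3⟩ := hz
  have hk1 := hk.one_lt
  have hV := lamPot_zero_le hk1 (z 0)
  have hW : -(2 * 1) - k ≤ nuPot m k (z 1) := by
    unfold nuPot
    have c1 := Real.cos_le_one (z 1)
    have c2 := Real.neg_one_le_cos (z 1)
    have c3 : Real.cos (z 1) ^ 2 ≤ 1 := by nlinarith
    nlinarith [hk.neg_one_lt, hk.lt_one,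
      mul_nonneg (sub_nonneg.2 c1) (by linarith [hk.neg_one_lt] : 0 ≤ m + 1)]
  unfold regEnergy at h3
  fin_cases i
  · have hch : Real.cosh (z 0) ≤ 3 := by
      have hV' : lamPot k (z 0) ≤ 2 + k := by nlinarith [sq_nonneg (z 2), sq_nonneg (z 3)]
      unfold lamPot at hV'
      by_contra hlt
      push Not at hlt
      nlinarith [mul_pos (by linarith : 0 < Real.cosh (z 0) + 1)
        (by nlinarith : 0 < k * (Real.cosh (z 0) - 1) - 2)]
    have h4 := Real.add_one_le_exp |z 0|
    have h5 := Real.exp_pos (-|z 0|)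
    rw [← Real.cosh_abs, Real.cosh_eq] at hch
    change |z 0| ≤ 7
    linarith
  · change |z 1| ≤ 7
    rw [abs_of_nonneg h1.1]
    linarith [h1.2, Real.pi_lt_d2]
  · change |z 2| ≤ 7
    exact abs_le_of_sq_le_sq (by nlinarith [sq_nonneg (z 2), sq_nonneg (z 3)]) (by norm_num)
  · change |z 3| ≤ 7
    exact abs_le_of_sq_le_sq (by nlinarith [sq_nonneg (z 2), sq_nonneg (z 3)]) (by norm_num)

lemma isCompact_wellBody : IsCompact (wellBody m k) := by
  have hcl : IsClosed (wellBody m k) := by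
    have h1 : Continuous fun z : Phase => z 1 := by fun_prop
    exact (isClosed_Icc.preimage h1).inter ((isClosed_le (Real.continuous_cos.comp h1)
      continuous_const).inter (isClosed_le (continuous_regEnergy m k) continuous_const))
  refine Metric.isCompact_of_isClosed_isBounded hcl ?_
  refine (Metric.isBounded_closedBall (x := (0 : Phase)) (r := 14)).subset fun z hz => ?_
  rw [mem_closedBall_zero_iff, EuclideanSpace.norm_eq]
  refine Real.sqrt_le_iff.2 ⟨by norm_num, ?_⟩
  rw [Fin.sum_univ_four]
  have h : ∀ i, ‖z i‖ ^ 2 ≤ 49 := fun i => by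
    have := abs_le_of_mem_wellBody hk hz i
    rw [Real.norm_eq_abs]
    nlinarith [abs_nonneg (z i)]
  linarith [h 0, h 1, h 2, h 3]

omit hk in
lemma isOpen_wellInterior : IsOpen (wellInterior m k) := by
  have h1 : Continuous fun z : Phase => z 1 := by fun_prop
  exact (isOpen_Ioo.preimage h1).inter ((isOpen_lt (Real.continuous_cos.comp h1)
    continuous_const).inter (isOpen_lt (continuous_regEnergy m k) continuous_const))

/-- The regularized Hamiltonian strictly increases along rays from the centre of the well. -/
lemma isStarBody_well : IsStarBody wellCenter (wellBody m k) (wellInterior m k) where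
  isCompact := isCompact_wellBody hk
  isOpen := isOpen_wellInterior
  center_mem := by
    have hpi := Real.pi_pos
    refine ⟨?_, ?_, regEnergy_wellCenter hk⟩
    · rw [wellCenter_one]
      exact ⟨hpi, by linarith⟩
    · rw [wellCenter_one, Real.cos_pi]
      exact hk.neg_one_lt_saddle
  subset := fun z hz => ⟨Ioo_subset_Icc_self hz.1, hz.2.1.le, hz.2.2.le⟩
  contract := by
    rintro z ⟨h1, h2, h3⟩ s ⟨hs0, hs1⟩
    set w := wellCenter + s • (z - wellCenter) with hw
    have hpi := Real.pi_pos
    have hk1 := hk.one_lt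
    have hs2 : s ^ 2 < 1 := pow_lt_one₀ hs0 hs1 (by norm_num)
    have w0 : w 0 = s * z 0 := by simp [hw]
    have w1 : w 1 = Real.pi + s * (z 1 - Real.pi) := by simp [hw]
    have w2 : w 2 = s * z 2 := by simp [hw]
    have w3 : w 3 = s * z 3 := by simp [hw]
    have hz1 : |z 1 - Real.pi| ≤ Real.pi := abs_le.2 ⟨by linarith [h1.1], by linarith [h1.2]⟩
    have hcw : Real.cos (w 1) = -Real.cos |s * (z 1 - Real.pi)| := by
      rw [w1, add_comm, Real.cos_add_pi, Real.cos_abs]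
    have hcz : Real.cos (z 1) = -Real.cos |z 1 - Real.pi| := by
      rw [Real.cos_abs, Real.cos_sub_pi, neg_neg]
    have habs : |s * (z 1 - Real.pi)| ≤ |z 1 - Real.pi| := by
      rw [abs_mul, abs_of_nonneg hs0]
      nlinarith [abs_nonneg (z 1 - Real.pi)]
    have hcos : Real.cos (w 1) ≤ Real.cos (z 1) := by
      rw [hcw, hcz, neg_le_neg_iff]
      exact Real.cos_le_cos_of_nonneg_of_le_pi (abs_nonneg _) hz1 habs
    have hmemI : w 1 ∈ Ioo 0 (2 * Real.pi) := by
      rw [w1]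
      obtain ⟨ha, hb⟩ := abs_le.1 hz1
      constructor <;> nlinarith
    have hVle : lamPot k (w 0) ≤ lamPot k (z 0) := by
      refine lamPot_mono hk1 ?_
      rw [w0, abs_mul, abs_of_nonneg hs0]
      nlinarith [abs_nonneg (z 0)]
    have hWle : nuPot m k (w 1) ≤ nuPot m k (z 1) := nuPot_mono hk1 hcos h2
    have h2le : w 2 ^ 2 ≤ z 2 ^ 2 := by
      rw [w2, mul_pow]
      exact mul_le_of_le_one_left (sq_nonneg _) hs2.le
    have h3le : w 3 ^ 2 ≤ z 3 ^ 2 := by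
      rw [w3, mul_pow]
      exact mul_le_of_le_one_left (sq_nonneg _) hs2.le
    have hsub : w 1 ∈ Ioo 0 (2 * Real.pi) ∧ Real.cos (w 1) ≤ m / k := ⟨hmemI, hcos.trans h2⟩
    have hneg : regEnergy m k w < 0 := by
      by_contra hcon
      push Not at hcon
      -- Equality would have to hold in each of the four terms, which forces `z` to be the centre.
      unfold regEnergy at h3 hcon
      have e0 : z 0 = 0 := by
        by_contra hne
        have : lamPot k (w 0) < lamPot k (z 0) := by
          refine lamPot_strictMono hk1 ?_
          rw [w0, abs_mul, abs_of_nonneg hs0]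
          nlinarith [abs_pos.2 hne]
        linarith
      have e1 : z 1 = Real.pi := by
        by_contra hne
        have hpos : 0 < |z 1 - Real.pi| := abs_pos.2 (sub_ne_zero.2 hne)
        have : nuPot m k (w 1) < nuPot m k (z 1) := by
          refine nuPot_strictMono hk1 ?_ h2
          rw [hcw, hcz, neg_lt_neg_iff]
          refine Real.cos_lt_cos_of_nonneg_of_le_pi (abs_nonneg _) hz1 ?_
          rw [abs_mul, abs_of_nonneg hs0]
          nlinarith
        linarith
      have e2 : z 2 = 0 := by
        by_contra hne
        have hpos : 0 < z 2 ^ 2 := by positivity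
        have : w 2 ^ 2 < z 2 ^ 2 := by
          rw [w2, mul_pow]
          exact mul_lt_of_lt_one_left hpos hs2
        linarith
      have e3 : z 3 = 0 := by
        by_contra hne
        have hpos : 0 < z 3 ^ 2 := by positivity
        have : w 3 ^ 2 < z 3 ^ 2 := by
          rw [w3, mul_pow]
          exact mul_lt_of_lt_one_left hpos hs2
        linarith
      have hwc : w = wellCenter := phase_ext (by simp [w0, e0]) (by simp [w1, e1])
        (by simp [w2, e2]) (by simp [w3, e3])
      have := regEnergy_wellCenter hk
      rw [← hwc] at this
      unfold regEnergy at this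
      linarith
    exact ⟨hmemI, lt_of_le_of_ne hsub.2 (cos_ne_of_regEnergy_nonpos hk hneg.le), hneg⟩

end Well

/-! ### The regularized Earth component -/

/-- The directions from the centre of the well that do not point to collision states. -/
def noncollisionCone : Set Phase := {u | u 0 ≠ 0 ∨ u 1 ≠ 0}

lemma zero_notMem_noncollisionCone : (0 : Phase) ∉ noncollisionCone := by
  simp [noncollisionCone]

lemma smul_mem_noncollisionCone (u : Phase) (hu : u ∈ noncollisionCone) (t : ℝ) (ht : 0 < t) :
    t • u ∈ noncollisionCone := by
  rcases hu with h | h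
  · exact Or.inl (by simpa using ⟨ht.ne', h⟩)
  · exact Or.inr (by simpa using ⟨ht.ne', h⟩)

/-- The collision directions, the plane `u₀ = u₁ = 0`, as the kernel of a linear map. -/
def collisionPlane : Submodule ℝ Phase :=
  LinearMap.ker ((EuclideanSpace.projₗ (𝕜 := ℝ) (0 : Fin 4)).prod
    (EuclideanSpace.projₗ (𝕜 := ℝ) (1 : Fin 4)) : Phase →ₗ[ℝ] ℝ × ℝ)

lemma compl_collisionPlane : ((collisionPlane : Set Phase))ᶜ = noncollisionCone := by
  ext u
  have : u ∈ collisionPlane ↔ u 0 = 0 ∧ u 1 = 0 := Prod.mk_eq_zero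
  rw [mem_compl_iff, SetLike.mem_coe, this, not_and_or]
  rfl

lemma isPreconnected_noncollisionCone : IsPreconnected noncollisionCone := by
  rw [← compl_collisionPlane]
  refine (isConnected_compl_of_one_lt_codim ?_).isPreconnected
  have hsurj : Function.Surjective ((EuclideanSpace.projₗ (𝕜 := ℝ) (0 : Fin 4)).prod
      (EuclideanSpace.projₗ (𝕜 := ℝ) (1 : Fin 4)) : Phase →ₗ[ℝ] ℝ × ℝ) := by
    rintro ⟨a, b⟩
    exact ⟨!₂[a, b, 0, 0], by simp⟩
  have hr : Module.rank ℝ (Phase ⧸ collisionPlane) = Module.rank ℝ (ℝ × ℝ) :=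
    (LinearMap.quotKerEquivOfSurjective _ hsurj).rank_eq
  rw [hr]
  simp
  norm_num

lemma dense_noncollisionCone : Dense noncollisionCone := by
  rw [← compl_collisionPlane, ← interior_eq_empty_iff_dense_compl]
  by_contra hne
  have htop := Submodule.eq_top_of_nonempty_interior' collisionPlane
    (nonempty_iff_ne_empty.2 hne)
  have : (EuclideanSpace.single (0 : Fin 4) (1 : ℝ) : Phase) ∈ noncollisionCone :=
    Or.inl (by simp)
  rw [← compl_collisionPlane, htop] at this
  exact this (by simp)

section Well

variable {m k : ℝ} (hk : Subcritical m k)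
include hk

lemma mem_ellipticDomain_iff_of_mem_wellSurface {z : Phase} (hz : z ∈ wellSurface m k) :
    z ∈ ellipticDomain ↔ z - wellCenter ∈ noncollisionCone := by
  rw [mem_ellipticDomain, ← not_iff_not, not_not, noncollisionCone, mem_ofPred_eq, not_or,
    not_not, not_not]
  simp only [PiLp.sub_apply, wellCenter_zero, wellCenter_one, sub_zero, sub_eq_zero]
  constructor
  · intro h
    have h1 := Real.one_le_cosh (z 0)
    have h2 := Real.cos_sq_le_one (z 1)
    have h3 : Real.cosh (z 0) = 1 := by nlinarith
    have h4 : Real.cos (z 1) ^ 2 = 1 := by rw [← h, h3]; norm_num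
    refine ⟨?_, ?_⟩
    · by_contra hne
      exact absurd h3 (Real.one_lt_cosh.2 hne).ne'
    · have h5 : Real.cos (z 1) = -1 := by
        rcases sq_eq_sq_iff_eq_or_eq_neg.1 (h4.trans (one_pow 2).symm) with h6 | h6
        · linarith [hz.2.1, hk.saddle_lt_one]
        · exact h6
      have h6 : Real.cos (z 1 - Real.pi) = 1 := by rw [Real.cos_sub_pi, h5, neg_neg]
      have := (Real.cos_eq_one_iff_of_lt_of_lt (by linarith [hz.1.1, Real.pi_pos])
        (by linarith [hz.1.2, Real.pi_pos])).1 h6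
      linarith
  · rintro ⟨h0, h1⟩
    rw [h0, h1]
    simp

lemma wellSurface_inter_ellipticDomain : wellSurface m k ∩ ellipticDomain =
    {z ∈ wellBody m k \ wellInterior m k | z - wellCenter ∈ noncollisionCone} := by
  rw [wellBody_diff_wellInterior hk]
  ext z
  exact and_congr_right fun hz => mem_ellipticDomain_iff_of_mem_wellSurface hk hz

/-- The states of the well without collisions form a connected set, since the radial projection
carries them onto the complement of a plane in `ℝ⁴`. -/
lemma isPreconnected_wellSurface_inter_ellipticDomain :
    IsPreconnected (wellSurface m k ∩ ellipticDomain) := by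
  have hs := isStarBody_well hk
  rw [wellSurface_inter_ellipticDomain hk,
    ← hs.image_exit zero_notMem_noncollisionCone smul_mem_noncollisionCone]
  exact isPreconnected_noncollisionCone.image _ (hs.continuousOn_exit zero_notMem_noncollisionCone)

lemma isPreconnected_wellSurface : IsPreconnected (wellSurface m k) := by
  have hs := isStarBody_well hk
  have h0 : (0 : Phase) ∉ ({0}ᶜ : Set Phase) := by simp
  have := hs.image_exit h0 (fun u hu t ht => by simpa using ⟨ht.ne', hu⟩)
  rw [wellBody_diff_wellInterior hk] at this
  have he : {z ∈ wellSurface m k | z - wellCenter ∈ ({0}ᶜ : Set Phase)} = wellSurface m k := by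
    ext z
    refine ⟨fun h => h.1, fun h => ⟨h, ?_⟩⟩
    rintro (h0 : z - wellCenter = 0)
    have h1 := regEnergy_wellCenter hk
    rw [← sub_eq_zero.1 h0, h.2.2] at h1
    exact lt_irrefl _ h1
  rw [← he, ← this]
  refine (isConnected_compl_singleton_of_one_lt_rank ?_ (0 : Phase)).isPreconnected.image _
    (hs.continuousOn_exit h0)
  rw [← Module.finrank_eq_rank]
  simp

lemma isClosed_wellSurface : IsClosed (wellSurface m k) := by
  rw [← wellBody_diff_wellInterior hk]
  exact (isCompact_wellBody hk).isClosed.sdiff isOpen_wellInterior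

lemma isCompact_wellSurface : IsCompact (wellSurface m k) := by
  rw [← wellBody_diff_wellInterior hk]
  exact (isCompact_wellBody hk).diff isOpen_wellInterior

lemma closure_wellSurface_inter_ellipticDomain :
    closure (wellSurface m k ∩ ellipticDomain) = wellSurface m k := by
  refine (closure_minimal inter_subset_left (isClosed_wellSurface hk)).antisymm ?_
  have := (isStarBody_well hk).diff_subset_closure zero_notMem_noncollisionCone
    smul_mem_noncollisionCone dense_noncollisionCone
  rwa [← wellSurface_inter_ellipticDomain hk, wellBody_diff_wellInterior hk] at this

/-- A collision state with the Earth. -/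
lemma collision_mem_wellSurface :
    (!₂[0, Real.pi, √(1 + m), 0] : Phase) ∈ wellSurface m k := by
  have hpi := Real.pi_pos
  refine ⟨?_, ?_, ?_⟩
  · simp [hpi]
  · simpa using hk.neg_one_lt_saddle
  · simp [regEnergy, lamPot, nuPot, Real.sq_sqrt (by linarith [hk.neg_one_lt] : 0 ≤ 1 + m)]
    ring

lemma wellSurface_eq_connectedComponentIn {z : Phase} (hz : z ∈ wellSurface m k) :
    wellSurface m k = connectedComponentIn {y | regEnergy m k y = 0} z := by
  have hz' : z ∈ {y | regEnergy m k y = 0} := hz.2.2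
  refine subset_antisymm ((isPreconnected_wellSurface hk).subset_connectedComponentIn hz
    fun y hy => hy.2.2) ?_
  -- The open strip and the complement of the closed strip separate the level set.
  have hsub := connectedComponentIn_subset {y | regEnergy m k y = 0} z
  have h1 : Continuous fun z : Phase => z 1 := by fun_prop
  set U : Set Phase := {y | y 1 ∈ Ioo 0 (2 * Real.pi) ∧ Real.cos (y 1) < m / k} with hU
  set V : Set Phase := {y | y 1 ∈ Icc 0 (2 * Real.pi) ∧ Real.cos (y 1) ≤ m / k}ᶜ with hV
  have hUo : IsOpen U := (isOpen_Ioo.preimage h1).inter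
    (isOpen_lt (Real.continuous_cos.comp h1) continuous_const)
  have hVo : IsOpen V := ((isClosed_Icc.preimage h1).inter
    (isClosed_le (Real.continuous_cos.comp h1) continuous_const)).isOpen_compl
  have hdisj : Disjoint U V := by
    rw [disjoint_left]
    exact fun y hyU hyV => hyV ⟨Ioo_subset_Icc_self hyU.1, hyU.2.le⟩
  have hcover : connectedComponentIn {y | regEnergy m k y = 0} z ⊆ U ∪ V := by
    intro y hy
    have hy0 : regEnergy m k y = 0 := hsub hy
    by_cases hyV : y ∈ V
    · exact Or.inr hyV
    · have hy' : y 1 ∈ Icc 0 (2 * Real.pi) ∧ Real.cos (y 1) ≤ m / k := not_not.1 hyV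
      exact Or.inl ⟨mem_Ioo_of_cos_le hk hy'.1 hy'.2,
        lt_of_le_of_ne hy'.2 (cos_ne_of_regEnergy_nonpos hk hy0.le)⟩
  have hin := isPreconnected_connectedComponentIn.subset_left_of_subset_union hUo hVo hdisj hcover
    ⟨z, mem_connectedComponentIn hz', hz.1, hz.2.1⟩
  exact fun y hy => ⟨(hin hy).1, (hin hy).2, hsub hy⟩

lemma deck_mem_wellSurface {z : Phase} (hz : z ∈ wellSurface m k) :
    deck z ∈ wellSurface m k ∧ deck z ≠ z := by
  refine ⟨⟨?_, ?_, ?_⟩, fun h => ?_⟩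
  · rw [deck_one]
    exact ⟨by linarith [hz.1.2], by linarith [hz.1.1]⟩
  · rw [deck_one, Real.cos_two_pi_sub]
    exact hz.2.1
  · have := hz.2.2
    simp only [regEnergy, lamPot, nuPot] at this
    simp only [regEnergy, lamPot, nuPot, deck_zero, deck_one, deck_two, deck_three,
      Real.cosh_neg, Real.cos_two_pi_sub, neg_sq]
    exact this
  · have hc : ∀ i, deck z i = z i := fun i => by rw [h]
    have h0 := hc 0
    have h1 := hc 1
    have h2 := hc 2
    have h3 := hc 3
    rw [deck_zero] at h0
    rw [deck_one] at h1
    rw [deck_two] at h2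
    rw [deck_three] at h3
    have hw : z = wellCenter := phase_ext (by rw [wellCenter_zero]; linarith)
      (by rw [wellCenter_one]; linarith) (by rw [wellCenter_two]; linarith)
      (by rw [wellCenter_three]; linarith)
    have := regEnergy_wellCenter hk
    rw [← hw, hz.2.2] at this
    exact lt_irrefl _ this

end Well

lemma regEnergy_eq_zero_iff {μ c : ℝ} {z : Phase} (hz : z ∈ ellipticDomain) :
    regEnergy (1 - 2 * μ) (-c) z = 0 ↔ hamiltonian μ (ellipticMap z) = c := by
  rw [regEnergy_eq_hamiltonian hz, mul_eq_zero, sub_eq_zero,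
    or_iff_left (mem_ellipticDomain.1 hz)]

lemma cos_eq_dist_sub_dist (z : Phase) : Real.cos (z 1) =
    dist (position (ellipticMap z)) earth - dist (position (ellipticMap z)) moon := by
  rw [dist_ellipticMap_earth, dist_ellipticMap_moon]
  ring

lemma continuous_position : Continuous position := by
  unfold position
  fun_prop

/-- The energy surface splits along the line through the saddle, and only its part on the Earth
side comes close to the Earth. -/
lemma image_wellSurface {μ c : ℝ} (hk : Subcritical (1 - 2 * μ) (-c)) :
    ellipticMap '' (wellSurface (1 - 2 * μ) (-c) ∩ ellipticDomain) = earthComponent μ c := by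
  set T := wellSurface (1 - 2 * μ) (-c) with hT
  have hsub : ellipticMap '' (T ∩ ellipticDomain) ⊆ energySurface μ c := by
    rintro _ ⟨z, ⟨hzT, hzD⟩, rfl⟩
    exact ⟨hzD, (regEnergy_eq_zero_iff hzD).1 hzT.2.2⟩
  have hconn : IsPreconnected (ellipticMap '' (T ∩ ellipticDomain)) :=
    (isPreconnected_wellSurface_inter_ellipticDomain hk).image _
      (contDiffOn_ellipticMap.continuousOn.mono inter_subset_right)
  have hacc : earth ∈ closure (position '' (ellipticMap '' (T ∩ ellipticDomain))) := by
    have hcol := collision_mem_wellSurface hk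
    rw [← closure_wellSurface_inter_ellipticDomain hk] at hcol
    have := mem_closure_image continuous_position_ellipticMap.continuousAt hcol
    rw [image_image]
    convert! this using 1
    ext i
    fin_cases i <;> simp [position, earth]
  apply subset_antisymm
  · intro x hx
    exact ⟨hsub hx, closure_mono (image_mono (hconn.subset_connectedComponentIn hx hsub)) hacc⟩
  · rintro x ⟨hx, hxacc⟩
    obtain ⟨z, hz1, rfl⟩ := exists_ellipticMap_eq hx.1
    have hzD : z ∈ ellipticDomain := hx.1
    have hz0 := (regEnergy_eq_zero_iff hzD).2 hx.2
    rcases lt_or_gt_of_ne (cos_ne_of_regEnergy_nonpos hk hz0.le) with hlt | hgt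
    · exact ⟨z, ⟨⟨mem_Ioo_of_cos_le hk (Ico_subset_Icc_self hz1) hlt.le, hlt, hz0⟩, hzD⟩, rfl⟩
    · exfalso
      set C := connectedComponentIn (energySurface μ c) (ellipticMap z) with hC
      set Y : Plane → ℝ := fun q => dist q earth - dist q moon with hY
      have hYc : Continuous Y := by
        simp only [hY]
        fun_prop
      have hcover : C ⊆ {x | (1 - 2 * μ) / (-c) < Y (position x)} ∪
          {x | Y (position x) < (1 - 2 * μ) / (-c)} := by
        intro x hxC
        have hxE := connectedComponentIn_subset _ _ hxC
        obtain ⟨y, -, rfl⟩ := exists_ellipticMap_eq hxE.1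
        have hyD : y ∈ ellipticDomain := hxE.1
        have hy := cos_ne_of_regEnergy_nonpos hk ((regEnergy_eq_zero_iff hyD).2 hxE.2).le
        rw [cos_eq_dist_sub_dist] at hy
        exact (lt_or_gt_of_ne hy).symm
      have hCsub := isPreconnected_connectedComponentIn.subset_left_of_subset_union
        (isOpen_lt continuous_const (hYc.comp continuous_position))
        (isOpen_lt (hYc.comp continuous_position) continuous_const)
        (disjoint_left.2 fun x h1 h2 => by
          rw [mem_ofPred_eq] at h1 h2
          exact lt_asymm h1 h2) hcover
        ⟨ellipticMap z, mem_connectedComponentIn hx, by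
          rw [cos_eq_dist_sub_dist] at hgt
          exact hgt⟩
      have hcl : position '' C ⊆ {q | (1 - 2 * μ) / (-c) ≤ Y q} := by
        rintro _ ⟨x, hxC, rfl⟩
        have := hCsub hxC
        rw [mem_ofPred_eq] at this
        exact this.le
      have h1 : (1 - 2 * μ) / (-c) ≤ Y earth :=
        closure_minimal hcl (isClosed_le continuous_const hYc) hxacc
      simp only [hY, dist_self, dist_earth_moon] at h1
      linarith [hk.neg_one_lt_saddle]

lemma regEarthComponent_eq {μ c : ℝ} (hk : Subcritical (1 - 2 * μ) (-c)) :
    regEarthComponent μ c = wellSurface (1 - 2 * μ) (-c) := by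
  rw [← closure_wellSurface_inter_ellipticDomain hk, regEarthComponent, ← image_wellSurface hk]
  congr 1
  ext z
  constructor
  · rintro ⟨hz1, y, ⟨hyT, hyD⟩, hyz⟩
    have hzD : z ∈ ellipticDomain := by
      rw [ellipticDomain, mem_preimage, ← hyz]
      exact hyD
    have hcos : Real.cos (z 1) < (1 - 2 * μ) / (-c) := by
      rw [cos_eq_dist_sub_dist, ← hyz, ← cos_eq_dist_sub_dist]
      exact hyT.2.1
    have h0 : regEnergy (1 - 2 * μ) (-c) z = 0 := by
      rw [regEnergy_eq_zero_iff hzD, ← hyz, ← regEnergy_eq_zero_iff hyD]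
      exact hyT.2.2
    exact ⟨⟨mem_Ioo_of_cos_le hk hz1 hcos.le, hcos, h0⟩, hzD⟩
  · intro hz
    exact ⟨Ioo_subset_Icc_self hz.1.1, z, hz, rfl⟩

lemma fibre_wellSurface {μ c : ℝ} (hk : Subcritical (1 - 2 * μ) (-c)) {z : Phase}
    (hz : z ∈ wellSurface (1 - 2 * μ) (-c) ∩ ellipticDomain) :
    {y ∈ wellSurface (1 - 2 * μ) (-c) ∩ ellipticDomain | ellipticMap y = ellipticMap z}
      = {z, deck z} := by
  have hd : partner z = deck z := partner_eq_deck hz.1.1.1.ne'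
  ext y
  simp only [mem_ofPred_eq, mem_insert_iff, mem_singleton_iff]
  constructor
  · rintro ⟨⟨hyT, -⟩, hy⟩
    rw [← hd]
    exact eq_or_eq_partner hz.2 (Ioo_subset_Ico_self hyT.1) (Ioo_subset_Ico_self hz.1.1) hy
  · rintro (rfl | rfl)
    · exact ⟨hz, rfl⟩
    · have he : ellipticMap (deck z) = ellipticMap z := hd ▸ ellipticMap_partner z
      refine ⟨⟨(deck_mem_wellSurface hk hz.1).1, ?_⟩, he⟩
      rw [ellipticDomain, mem_preimage, he]
      exact hz.2

/-! ### The Gauss–Kronecker curvature of separable level sets -/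

section Separable

open InnerProductSpace

variable {F : Phase → ℝ} {f f' f'' : Fin 4 → ℝ → ℝ}

lemma hasGradientAt_separable (hF : ∀ z, F z = ∑ i, f i (z i))
    (hf : ∀ i t, HasDerivAt (f i) (f' i t) t) (z : Phase) :
    HasGradientAt F (WithLp.toLp 2 fun i => f' i (z i)) z := by
  rw [hasGradientAt_iff_hasFDerivAt]
  have h : HasFDerivAt (fun z : Phase => ∑ i, f i (z i))
      (∑ i, f' i (z i) • (EuclideanSpace.proj i : Phase →L[ℝ] ℝ)) z :=
    HasFDerivAt.fun_sum fun i _ => (hf i (z i)).comp_hasFDerivAt z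
      (EuclideanSpace.proj i : Phase →L[ℝ] ℝ).hasFDerivAt
  rw [show F = fun z => ∑ i, f i (z i) from funext hF]
  refine h.congr_fderiv ?_
  ext v
  simp [PiLp.inner_apply, mul_comm]

lemma gradient_separable (hF : ∀ z, F z = ∑ i, f i (z i))
    (hf : ∀ i t, HasDerivAt (f i) (f' i t) t) :
    gradient F = fun z => WithLp.toLp 2 fun i => f' i (z i) :=
  funext fun z => (hasGradientAt_separable hF hf z).gradient

lemma hasFDerivAt_gradient_separable (hF : ∀ z, F z = ∑ i, f i (z i))
    (hf : ∀ i t, HasDerivAt (f i) (f' i t) t) (hf' : ∀ i t, HasDerivAt (f' i) (f'' i t) t)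
    (z : Phase) : ∃ H : Phase →L[ℝ] Phase, (∀ v i, H v i = f'' i (z i) * v i) ∧
      HasFDerivAt (gradient F) H z := by
  have hd : DifferentiableAt ℝ (gradient F) z := by
    rw [gradient_separable hF hf, differentiableAt_euclidean]
    exact fun i => ((hf' i (z i)).comp_hasFDerivAt z
      (EuclideanSpace.proj i : Phase →L[ℝ] ℝ).hasFDerivAt).differentiableAt
  refine ⟨fderiv ℝ (gradient F) z, fun v i => ?_, hd.hasFDerivAt⟩
  have h1 : HasFDerivAt (fun w => gradient F w i)
      ((EuclideanSpace.proj i : Phase →L[ℝ] ℝ) ∘L fderiv ℝ (gradient F) z) z :=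
    (EuclideanSpace.proj i : Phase →L[ℝ] ℝ).hasFDerivAt.comp z hd.hasFDerivAt
  have h2 : HasFDerivAt (fun w => gradient F w i)
      (f'' i (z i) • (EuclideanSpace.proj i : Phase →L[ℝ] ℝ)) z := by
    rw [gradient_separable hF hf]
    exact (hf' i (z i)).comp_hasFDerivAt z (EuclideanSpace.proj i : Phase →L[ℝ] ℝ).hasFDerivAt
  have := congrArg (fun L : Phase →L[ℝ] ℝ => L v) (h1.unique h2)
  simpa using this

/-- On the tangent space, the quadratic form of the shape operator is the Hessian divided by the
norm of the gradient. -/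
lemma inner_shapeOperator {z : Phase} (hz : gradient F z ≠ 0) {H : Phase →L[ℝ] Phase}
    (hH : HasFDerivAt (gradient F) H z) (v w : tangentAt F z) :
    ⟪w, shapeOperator F z v⟫_ℝ = ‖gradient F z‖⁻¹ * ⟪(w : Phase), H v⟫_ℝ := by
  have hn : DifferentiableAt ℝ (fun y => ‖gradient F y‖⁻¹) z :=
    (hH.differentiableAt.norm ℝ hz).inv (norm_ne_zero_iff.2 hz)
  have hN := (hn.hasFDerivAt.smul hH).fderiv
  have hw : ⟪(w : Phase), gradient F z⟫_ℝ = 0 := by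
    have := Submodule.mem_orthogonal_singleton_iff_inner_left.1 w.2
    exact this
  have hdef : shapeOperator F z v =
      (tangentAt F z).orthogonalProjectionOnto (fderiv ℝ (unitNormal F) z v) := rfl
  rw [hdef, Submodule.inner_orthogonalProjectionOnto_eq_of_mem_left,
    show unitNormal F = (fun y => ‖gradient F y‖⁻¹) • gradient F from rfl, hN]
  simp [inner_add_right, inner_smul_right, hw]

/-- The quaternions `i n, j n, k n`, which span the orthogonal complement of `n`. -/
def quaternionFrame (n : Phase) : Fin 3 → Phase :=
  ![!₂[-n 1, n 0, -n 3, n 2], !₂[-n 2, n 3, n 0, -n 1], !₂[-n 3, -n 2, n 1, n 0]]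

lemma inner_eq_sum_four (v w : Phase) :
    ⟪v, w⟫_ℝ = v 0 * w 0 + v 1 * w 1 + v 2 * w 2 + v 3 * w 3 := by
  simp [PiLp.inner_apply, Fin.sum_univ_four, mul_comm]

lemma norm_sq_eq_sum_four (v : Phase) :
    ‖v‖ ^ 2 = v 0 ^ 2 + v 1 ^ 2 + v 2 ^ 2 + v 3 ^ 2 := by
  rw [← real_inner_self_eq_norm_sq, inner_eq_sum_four]
  ring

lemma orthonormal_quaternionFrame {n : Phase} (hn : ‖n‖ = 1) :
    Orthonormal ℝ (quaternionFrame n) := by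
  have h := norm_sq_eq_sum_four n
  rw [hn] at h
  rw [orthonormal_iff_ite]
  intro i j
  fin_cases i <;> fin_cases j <;> rw [inner_eq_sum_four] <;> simp [quaternionFrame] <;> linarith

lemma inner_quaternionFrame (n : Phase) (i : Fin 3) : ⟪n, quaternionFrame n i⟫_ℝ = 0 := by
  fin_cases i <;> rw [inner_eq_sum_four] <;> simp [quaternionFrame] <;> ring

/-- The determinant of the compression of a diagonal quadratic form to the orthogonal complement of
`n`, computed in the quaternionic frame. -/
lemma det_compression (n h : Fin 4 → ℝ) (e : Fin 3 → Fin 4 → ℝ)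
    (he : e = ![![-n 1, n 0, -n 3, n 2], ![-n 2, n 3, n 0, -n 1], ![-n 3, -n 2, n 1, n 0]]) :
    (Matrix.of fun i j : Fin 3 => e i 0 * (h 0 * e j 0) + e i 1 * (h 1 * e j 1)
      + e i 2 * (h 2 * e j 2) + e i 3 * (h 3 * e j 3)).det =
    (n 0 ^ 2 + n 1 ^ 2 + n 2 ^ 2 + n 3 ^ 2) ^ 2 *
      (n 0 ^ 2 * (h 1 * h 2 * h 3) + n 1 ^ 2 * (h 0 * h 2 * h 3) + n 2 ^ 2 * (h 0 * h 1 * h 3)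
        + n 3 ^ 2 * (h 0 * h 1 * h 2)) := by
  subst he
  rw [Matrix.det_fin_three]
  simp only [Matrix.of_apply, Matrix.cons_val_zero, Matrix.cons_val_one, Matrix.cons_val]
  ring

/-- The Gauss–Kronecker curvature of a regular level set of a sum of functions of one variable. -/
lemma gaussKronecker_separable (hF : ∀ z, F z = ∑ i, f i (z i))
    (hf : ∀ i t, HasDerivAt (f i) (f' i t) t) (hf' : ∀ i t, HasDerivAt (f' i) (f'' i t) t)
    {z : Phase} (hz : gradient F z ≠ 0) :
    gaussKronecker F z = (‖gradient F z‖⁻¹) ^ 5 *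
      (f' 0 (z 0) ^ 2 * (f'' 1 (z 1) * f'' 2 (z 2) * f'' 3 (z 3)) +
        f' 1 (z 1) ^ 2 * (f'' 0 (z 0) * f'' 2 (z 2) * f'' 3 (z 3)) +
        f' 2 (z 2) ^ 2 * (f'' 0 (z 0) * f'' 1 (z 1) * f'' 3 (z 3)) +
        f' 3 (z 3) ^ 2 * (f'' 0 (z 0) * f'' 1 (z 1) * f'' 2 (z 2))) := by
  obtain ⟨H, hHv, hH⟩ := hasFDerivAt_gradient_separable hF hf hf' z
  set r := ‖gradient F z‖⁻¹ with hr
  set n : Phase := r • gradient F z with hn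
  have hnorm : ‖n‖ = 1 := norm_smul_inv_norm (𝕜 := ℝ) hz
  have hr0 : r ≠ 0 := inv_ne_zero (norm_ne_zero_iff.2 hz)
  have hmem : ∀ i, quaternionFrame n i ∈ tangentAt F z := fun i => by
    have := inner_quaternionFrame n i
    rw [hn, inner_smul_left] at this
    rw [Submodule.mem_orthogonal_singleton_iff_inner_right]
    exact (mul_eq_zero.1 this).resolve_left (by simpa using hr0)
  set e : Fin 3 → tangentAt F z := fun i => ⟨quaternionFrame n i, hmem i⟩ with he
  have hon : Orthonormal ℝ e := by
    have := orthonormal_quaternionFrame hnorm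
    rw [orthonormal_iff_ite] at this ⊢
    exact this
  have : Fact (Module.finrank ℝ Phase = 3 + 1) := ⟨by simp⟩
  have hdim : Fintype.card (Fin 3) = Module.finrank ℝ (tangentAt F z) := by
    rw [Submodule.finrank_orthogonal_span_singleton (n := 3) hz]
    simp
  set b := basisOfOrthonormalOfCardEqFinrank hon hdim with hb
  have hbe : ⇑b = e := coe_basisOfOrthonormalOfCardEqFinrank hon hdim
  set b' := b.toOrthonormalBasis (by rw [hbe]; exact hon) with hb'
  have hentry : LinearMap.toMatrix b b (shapeOperator F z) = r • Matrix.of fun i j : Fin 3 =>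
      quaternionFrame n i 0 * (f'' 0 (z 0) * quaternionFrame n j 0)
      + quaternionFrame n i 1 * (f'' 1 (z 1) * quaternionFrame n j 1)
      + quaternionFrame n i 2 * (f'' 2 (z 2) * quaternionFrame n j 2)
      + quaternionFrame n i 3 * (f'' 3 (z 3) * quaternionFrame n j 3) := by
    ext i j
    rw [LinearMap.toMatrix_apply, hbe]
    have h1 : b.repr (shapeOperator F z (e j)) i = ⟪e i, shapeOperator F z (e j)⟫_ℝ := by
      have := b'.repr_apply_apply (shapeOperator F z (e j)) i
      simpa [hb', hbe] using this
    rw [h1, inner_shapeOperator hz hH, inner_eq_sum_four]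
    simp only [hHv, Matrix.smul_apply, Matrix.of_apply, smul_eq_mul, he]
    rfl
  have hfr : (fun i j => quaternionFrame n i j) =
      ![![-n 1, n 0, -n 3, n 2], ![-n 2, n 3, n 0, -n 1], ![-n 3, -n 2, n 1, n 0]] := by
    ext i j
    fin_cases i <;> fin_cases j <;> simp [quaternionFrame]
  have hg : ∀ i, n i = r * f' i (z i) := fun i => by
    rw [hn, gradient_separable hF hf]
    simp
  rw [gaussKronecker, ← LinearMap.det_toMatrix b, hentry, Matrix.det_smul,
    det_compression n (fun i => f'' i (z i)) _ hfr, ← norm_sq_eq_sum_four, hnorm, hg, hg, hg, hg]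
  simp
  ring

end Separable

/-! ### Curvature of the regularized Earth component -/

/-- The derivative of `lamPot k`. -/
def lamPotDeriv (k a : ℝ) : ℝ := 2 * Real.sinh a * (k * Real.cosh a - 1)

/-- The second derivative of `lamPot k`. -/
def lamPotDeriv2 (k a : ℝ) : ℝ := 4 * k * Real.cosh a ^ 2 - 2 * Real.cosh a - 2 * k

/-- The derivative of `nuPot m k`. -/
def nuPotDeriv (m k b : ℝ) : ℝ := 2 * Real.sin b * (k * Real.cos b - m)

/-- The second derivative of `nuPot m k`. -/
def nuPotDeriv2 (m k b : ℝ) : ℝ := 4 * k * Real.cos b ^ 2 - 2 * m * Real.cos b - 2 * k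

lemma hasDerivAt_lamPot (k a : ℝ) : HasDerivAt (lamPot k) (lamPotDeriv k a) a := by
  refine ((((Real.hasDerivAt_cosh a).pow 2).const_mul k).sub
    ((Real.hasDerivAt_cosh a).const_mul 2)).congr_deriv ?_
  simp only [lamPotDeriv]
  ring

lemma hasDerivAt_lamPotDeriv (k a : ℝ) :
    HasDerivAt (lamPotDeriv k) (lamPotDeriv2 k a) a := by
  refine (((Real.hasDerivAt_sinh a).const_mul 2).mul
    (((Real.hasDerivAt_cosh a).const_mul k).sub_const 1)).congr_deriv ?_
  simp only [lamPotDeriv2]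
  have := Real.sinh_sq a
  linear_combination 2 * k * this

lemma hasDerivAt_nuPot (m k b : ℝ) : HasDerivAt (nuPot m k) (nuPotDeriv m k b) b := by
  refine (((Real.hasDerivAt_cos b).const_mul (2 * m)).sub
    (((Real.hasDerivAt_cos b).pow 2).const_mul k)).congr_deriv ?_
  simp only [nuPotDeriv]
  ring

lemma hasDerivAt_nuPotDeriv (m k b : ℝ) :
    HasDerivAt (nuPotDeriv m k) (nuPotDeriv2 m k b) b := by
  refine (((Real.hasDerivAt_sin b).const_mul 2).mul
    (((Real.hasDerivAt_cos b).const_mul k).sub_const m)).congr_deriv ?_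
  simp only [nuPotDeriv2]
  have := Real.sin_sq b
  linear_combination -2 * k * this

lemma hasDerivAt_kinetic (t : ℝ) : HasDerivAt (fun t : ℝ => 2 * t ^ 2) (4 * t) t := by
  refine ((hasDerivAt_pow 2 t).const_mul 2).congr_deriv ?_
  simp
  ring

lemma hasDerivAt_kineticDeriv (t : ℝ) : HasDerivAt (fun t : ℝ => 4 * t) 4 t := by
  simpa using (hasDerivAt_id t).const_mul 4

/-- The four one-variable summands of `regEnergy m k`. -/
def summand (m k : ℝ) : Fin 4 → ℝ → ℝ :=
  ![lamPot k, nuPot m k, fun t => 2 * t ^ 2, fun t => 2 * t ^ 2]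

/-- The derivatives of the summands of `regEnergy m k`. -/
def summandDeriv (m k : ℝ) : Fin 4 → ℝ → ℝ :=
  ![lamPotDeriv k, nuPotDeriv m k, fun t => 4 * t, fun t => 4 * t]

/-- The second derivatives of the summands of `regEnergy m k`. -/
def summandDeriv2 (m k : ℝ) : Fin 4 → ℝ → ℝ :=
  ![lamPotDeriv2 k, nuPotDeriv2 m k, fun _ => 4, fun _ => 4]

lemma regEnergy_eq_sum (m k : ℝ) (z : Phase) : regEnergy m k z = ∑ i, summand m k i (z i) := by
  simp [Fin.sum_univ_four, summand, regEnergy]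

lemma hasDerivAt_summand (m k : ℝ) (i : Fin 4) (t : ℝ) :
    HasDerivAt (summand m k i) (summandDeriv m k i t) t := by
  fin_cases i
  · exact hasDerivAt_lamPot k t
  · exact hasDerivAt_nuPot m k t
  · exact hasDerivAt_kinetic t
  · exact hasDerivAt_kinetic t

lemma hasDerivAt_summandDeriv (m k : ℝ) (i : Fin 4) (t : ℝ) :
    HasDerivAt (summandDeriv m k i) (summandDeriv2 m k i t) t := by
  fin_cases i
  · exact hasDerivAt_lamPotDeriv k t
  · exact hasDerivAt_nuPotDeriv m k t
  · exact hasDerivAt_kineticDeriv t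
  · exact hasDerivAt_kineticDeriv t

/-- The numerator of the Gauss–Kronecker curvature, up to the factor `16`. -/
def curvatureForm (m k : ℝ) (z : Phase) : ℝ :=
  lamPotDeriv k (z 0) ^ 2 * nuPotDeriv2 m k (z 1) +
    nuPotDeriv m k (z 1) ^ 2 * lamPotDeriv2 k (z 0) +
    4 * (z 2 ^ 2 + z 3 ^ 2) * (lamPotDeriv2 k (z 0) * nuPotDeriv2 m k (z 1))

lemma gaussKronecker_regEnergy {m k : ℝ} {z : Phase} (hz : gradient (regEnergy m k) z ≠ 0) :
    gaussKronecker (regEnergy m k) z =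
      (‖gradient (regEnergy m k) z‖⁻¹) ^ 5 * (16 * curvatureForm m k z) := by
  rw [gaussKronecker_separable (regEnergy_eq_sum m k) (hasDerivAt_summand m k)
    (hasDerivAt_summandDeriv m k) hz]
  simp only [summandDeriv, summandDeriv2, curvatureForm, Matrix.cons_val_zero,
    Matrix.cons_val_one, Matrix.cons_val]
  ring

/-- The first and second derivatives of `regEnergy` along a line. -/
lemma hasDerivAt_regEnergy_line (m k : ℝ) (x v : Phase) (s : ℝ) :
    HasDerivAt (fun s : ℝ => regEnergy m k (x + s • v))
      (∑ i, summandDeriv m k i ((x + s • v) i) * v i) s ∧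
    HasDerivAt (fun s : ℝ => ∑ i, summandDeriv m k i ((x + s • v) i) * v i)
      (∑ i, summandDeriv2 m k i ((x + s • v) i) * v i ^ 2) s := by
  have hl : ∀ i, HasDerivAt (fun s : ℝ => (x + s • v) i) (v i) s := fun i => by
    simpa using ((hasDerivAt_id s).mul_const (v i)).const_add (x i)
  constructor
  · simp only [regEnergy_eq_sum]
    exact HasDerivAt.fun_sum fun i _ => (hasDerivAt_summand m k i _).comp s (hl i)
  · refine (HasDerivAt.fun_sum fun i _ =>
      ((hasDerivAt_summandDeriv m k i _).comp s (hl i)).mul_const (v i)).congr_deriv ?_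
    exact Finset.sum_congr rfl fun i _ => by ring

lemma lamPotDeriv2_pos {k : ℝ} (hk : 1 < k) (a : ℝ) : 0 < lamPotDeriv2 k a := by
  have := Real.one_le_cosh a
  unfold lamPotDeriv2
  nlinarith [mul_pos (sub_pos.2 hk) (by nlinarith : 0 < 2 * Real.cosh a ^ 2 - 1),
    mul_nonneg (sub_nonneg.2 this) (by linarith : 0 ≤ 2 * Real.cosh a + 1)]

section Well

variable {m k : ℝ} (hk : Subcritical m k)
include hk

/-- The only critical points over the well are the lifts of the Earth with zero momenta, where the
regularized Hamiltonian is negative. -/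
lemma gradient_regEnergy_ne_zero {z : Phase} (hz : z ∈ wellSurface m k) :
    gradient (regEnergy m k) z ≠ 0 := by
  intro h
  rw [gradient_separable (regEnergy_eq_sum m k) (hasDerivAt_summand m k)] at h
  have hi : ∀ i, summandDeriv m k i (z i) = 0 := fun i => congrArg (fun x : Phase => x i) h
  have h0 : 2 * Real.sinh (z 0) * (k * Real.cosh (z 0) - 1) = 0 := hi 0
  have h1 : 2 * Real.sin (z 1) * (k * Real.cos (z 1) - m) = 0 := hi 1
  have h2 : 4 * z 2 = 0 := hi 2
  have h3 : 4 * z 3 = 0 := hi 3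
  have hk1 := hk.one_lt
  have hch := Real.one_le_cosh (z 0)
  have e0 : z 0 = 0 := by
    rcases mul_eq_zero.1 h0 with h | h
    · exact Real.sinh_eq_zero.1 (by linarith)
    · nlinarith
  have hcos := hz.2.1
  rw [lt_div_iff₀ (by linarith)] at hcos
  have e1 : Real.cos (z 1) = -1 := by
    rcases mul_eq_zero.1 h1 with h | h
    · have hs : Real.sin (z 1) = 0 := by linarith
      have h4 := Real.sin_sq_add_cos_sq (z 1)
      rw [hs] at h4
      rcases sq_eq_sq_iff_eq_or_eq_neg.1 (by linarith : Real.cos (z 1) ^ 2 = 1 ^ 2) with h | h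
      · rw [h] at hcos
        linarith [hk.lt_one]
      · exact h
    · linarith
  have := hz.2.2
  rw [regEnergy, lamPot, nuPot, e0, e1, Real.cosh_zero, show z 2 = 0 by linarith,
    show z 3 = 0 by linarith] at this
  linarith [hk.neg_one_lt]

end Well

/-- The polynomial in `y = cos nu` whose sign decides the sign of the curvature: it is a positive
multiple of `curvatureForm` at the states with `lam = 0`, and these are the worst ones. -/
def criterion (m k y : ℝ) : ℝ :=
  (1 - y ^ 2) * (k ^ 2 - 2 * k + m ^ 2) + (k * y ^ 2 - 2 * m * y + 2 - k) * (y * (k * y - m))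

lemma four_mul_criterion (m k b : ℝ) : 4 * criterion m k (Real.cos b) =
    nuPotDeriv m k b ^ 2 + 2 * (2 - k - nuPot m k b) * nuPotDeriv2 m k b := by
  simp only [criterion, nuPotDeriv, nuPotDeriv2, nuPot, mul_pow, Real.sin_sq]
  ring

/-- The inequality `V'² / V'' - 2 V ≤ 2 (2 - k)` for `V = lamPot k`: its left-hand side decreases
in `|lam|`, and equality holds at `lam = 0`. -/
lemma lamPotDeriv_sq_le {k : ℝ} (hk : 1 < k) (a : ℝ) :
    lamPotDeriv k a ^ 2 ≤ 2 * (lamPot k a + 2 - k) * lamPotDeriv2 k a := by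
  have hx := Real.one_le_cosh a
  simp only [lamPotDeriv, lamPotDeriv2, lamPot, mul_pow, Real.sinh_sq]
  set x := Real.cosh a
  have h : 0 ≤ (x - 1) ^ 2 * (k * x * (k * x + 2 * k - 3) + (k - 1) ^ 2) := by
    have : 0 ≤ k * x + 2 * k - 3 := by nlinarith
    positivity
  linarith [show 2 * (k * x ^ 2 - 2 * x + 2 - k) * (4 * k * x ^ 2 - 2 * x - 2 * k)
    - 2 ^ 2 * (x ^ 2 - 1) * (k * x - 1) ^ 2
      = 4 * ((x - 1) ^ 2 * (k * x * (k * x + 2 * k - 3) + (k - 1) ^ 2)) by ring]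

section Well

variable {m k : ℝ} (hk : Subcritical m k)
include hk

lemma curvatureForm_pos {z : Phase} (hz : z ∈ wellSurface m k)
    (hcrit : 0 < criterion m k (Real.cos (z 1))) : 0 < curvatureForm m k z := by
  have hV2 := lamPotDeriv2_pos hk.one_lt (z 0)
  have hV := lamPotDeriv_sq_le hk.one_lt (z 0)
  have hc := four_mul_criterion m k (z 1)
  have h0 := hz.2.2
  simp only [regEnergy] at h0
  rcases le_or_gt (nuPotDeriv2 m k (z 1)) 0 with hW | hW
  · have hkin : 4 * (z 2 ^ 2 + z 3 ^ 2) = -2 * (lamPot k (z 0) + nuPot m k (z 1)) := by linarith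
    have : curvatureForm m k z = 4 * criterion m k (Real.cos (z 1)) * lamPotDeriv2 k (z 0) +
        -nuPotDeriv2 m k (z 1) * (2 * (lamPot k (z 0) + 2 - k) * lamPotDeriv2 k (z 0)
          - lamPotDeriv k (z 0) ^ 2) := by
      rw [curvatureForm, hkin, hc]
      ring
    rw [this]
    exact add_pos_of_pos_of_nonneg (by positivity)
      (mul_nonneg (by linarith) (sub_nonneg.2 hV))
  · have hnn : 0 ≤ curvatureForm m k z := by
      unfold curvatureForm
      positivity
    refine lt_of_le_of_ne hnn fun he => gradient_regEnergy_ne_zero hk hz ?_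
    -- All three nonnegative terms of the curvature form vanish, hence so does the gradient.
    unfold curvatureForm at he
    have t1 : 0 ≤ lamPotDeriv k (z 0) ^ 2 * nuPotDeriv2 m k (z 1) := by positivity
    have t2 : 0 ≤ nuPotDeriv m k (z 1) ^ 2 * lamPotDeriv2 k (z 0) := by positivity
    have t3 : 0 ≤ 4 * (z 2 ^ 2 + z 3 ^ 2) *
        (lamPotDeriv2 k (z 0) * nuPotDeriv2 m k (z 1)) := by positivity
    have e1 : lamPotDeriv k (z 0) = 0 := by
      have := (mul_eq_zero.1 (by linarith : lamPotDeriv k (z 0) ^ 2 * nuPotDeriv2 m k (z 1)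
        = 0)).resolve_right hW.ne'
      simpa using this
    have e2 : nuPotDeriv m k (z 1) = 0 := by
      have := (mul_eq_zero.1 (by linarith : nuPotDeriv m k (z 1) ^ 2 * lamPotDeriv2 k (z 0)
        = 0)).resolve_right hV2.ne'
      simpa using this
    have e3 : 4 * (z 2 ^ 2 + z 3 ^ 2) = 0 :=
      (mul_eq_zero.1 (by linarith : 4 * (z 2 ^ 2 + z 3 ^ 2) *
        (lamPotDeriv2 k (z 0) * nuPotDeriv2 m k (z 1)) = 0)).resolve_right (by positivity)
    have e4 : z 2 = 0 := by nlinarith [sq_nonneg (z 2), sq_nonneg (z 3)]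
    have e5 : z 3 = 0 := by nlinarith [sq_nonneg (z 2), sq_nonneg (z 3)]
    rw [gradient_separable (regEnergy_eq_sum m k) (hasDerivAt_summand m k)]
    refine phase_ext ?_ ?_ ?_ ?_ <;> simp [summandDeriv, e1, e2, e4, e5]

/-- Where the curvature form is positive, the Hessian is positive definite on the tangent space.
At most one coefficient of the diagonal Hessian is negative, and the Cauchy–Schwarz inequality for
the three others turns the determinant condition into definiteness. -/
lemma hessian_pos {z v : Phase} (hcurv : 0 < curvatureForm m k z) (hv : v ≠ 0)
    (htan : ∑ i, summandDeriv m k i (z i) * v i = 0) :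
    0 < ∑ i, summandDeriv2 m k i (z i) * v i ^ 2 := by
  have hV2 := lamPotDeriv2_pos hk.one_lt (z 0)
  rw [Fin.sum_univ_four] at htan ⊢
  simp only [summandDeriv, summandDeriv2, curvatureForm, Matrix.cons_val_zero,
    Matrix.cons_val_one, Matrix.cons_val] at htan hcurv ⊢
  generalize lamPotDeriv2 k (z 0) = A at *
  generalize nuPotDeriv2 m k (z 1) = B at *
  generalize lamPotDeriv k (z 0) = a at *
  generalize nuPotDeriv m k (z 1) = b at *
  have hne : ¬ (v 0 = 0 ∧ v 1 = 0 ∧ v 2 = 0 ∧ v 3 = 0) := fun ⟨h0, h1, h2, h3⟩ =>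
    hv (phase_ext h0 h1 h2 h3)
  by_cases hv1 : v 1 = 0
  · rw [hv1]
    have hnn : 0 ≤ A * v 0 ^ 2 + 4 * v 2 ^ 2 + 4 * v 3 ^ 2 := by positivity
    have : 0 < A * v 0 ^ 2 + 4 * v 2 ^ 2 + 4 * v 3 ^ 2 := by
      refine lt_of_le_of_ne hnn fun he => hne ?_
      have t1 : 0 ≤ A * v 0 ^ 2 := by positivity
      have e0 : A * v 0 ^ 2 = 0 := by nlinarith [sq_nonneg (v 2), sq_nonneg (v 3)]
      refine ⟨by simpa [hV2.ne'] using e0, hv1, ?_, ?_⟩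
      · nlinarith [sq_nonneg (v 2), sq_nonneg (v 3)]
      · nlinarith [sq_nonneg (v 2), sq_nonneg (v 3)]
    linarith
  · set N := a ^ 2 + 4 * (z 2 ^ 2 + z 3 ^ 2) * A with hN
    set T := A * v 0 ^ 2 + 4 * v 2 ^ 2 + 4 * v 3 ^ 2 with hT
    have hN0 : 0 ≤ N := by positivity
    have hcs : A * (b * v 1) ^ 2 ≤ N * T := by
      have e : b * v 1 = -(a * v 0 + 4 * z 2 * v 2 + 4 * z 3 * v 3) := by linarith
      have key : N * T - A * (a * v 0 + 4 * z 2 * v 2 + 4 * z 3 * v 3) ^ 2 =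
          (2 * a * v 2 - 2 * z 2 * A * v 0) ^ 2 + (2 * a * v 3 - 2 * z 3 * A * v 0) ^ 2
            + A * (4 * z 2 * v 3 - 4 * z 3 * v 2) ^ 2 := by
        rw [hN, hT]
        ring
      have : 0 ≤ (2 * a * v 2 - 2 * z 2 * A * v 0) ^ 2 + (2 * a * v 3 - 2 * z 3 * A * v 0) ^ 2
            + A * (4 * z 2 * v 3 - 4 * z 3 * v 2) ^ 2 := by positivity
      rw [e, neg_sq]
      linarith
    have hv1' : 0 < v 1 ^ 2 := by positivity
    have h1 : 0 < (B * N + b ^ 2 * A) * v 1 ^ 2 := by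
      refine mul_pos ?_ hv1'
      rw [hN]
      linarith
    have h2 : 0 < N * (T + B * v 1 ^ 2) := by nlinarith
    have : 0 < T + B * v 1 ^ 2 := by
      by_contra hle
      exact absurd h2 (not_lt.2 (mul_nonpos_of_nonneg_of_nonpos hN0 (not_lt.1 hle)))
    rw [hT] at this
    linarith

/-- Positive curvature makes the regularized Hamiltonian, restricted to a line tangent to the
surface, have a strict local minimum at the point of tangency, so a segment in the body cannot touch
the surface from inside. -/
lemma isStrictlyConvexHypersurface_well
    (hcrit : ∀ z ∈ wellSurface m k, 0 < criterion m k (Real.cos (z 1))) :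
    IsStrictlyConvexHypersurface (regEnergy m k) (wellSurface m k) where
  regular := fun z hz => gradient_regEnergy_ne_zero hk hz
  curvature_pos := fun z hz => by
    have hg := gradient_regEnergy_ne_zero hk hz
    have := curvatureForm_pos hk hz (hcrit z hz)
    have hn : 0 < ‖gradient (regEnergy m k) z‖ := norm_pos_iff.2 hg
    rw [gaussKronecker_regEnergy hg]
    positivity
  bounds := by
    have hs := isStarBody_well hk
    refine ⟨wellBody m k, hs.isCompact, ⟨wellCenter, ?_⟩, hs.strictConvex ?_, ?_⟩
    · rw [hs.interior_eq]
      exact hs.center_mem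
    · intro x y hxy hseg t ht
      by_contra hO
      have hz : x + t • (y - x) ∈ wellSurface m k := by
        rw [← wellBody_diff_wellInterior hk]
        exact ⟨hseg t (Ioo_subset_Icc_self ht), hO⟩
      have hd := hasDerivAt_regEnergy_line m k x (y - x)
      have hmem : ∀ᶠ s in nhds t, regEnergy m k (x + s • (y - x)) ≤ 0 := by
        filter_upwards [Ioo_mem_nhds ht.1 ht.2] with s hs'
        exact (hseg s (Ioo_subset_Icc_self hs')).2.2
      have hmax : IsLocalMax (fun s : ℝ => regEnergy m k (x + s • (y - x))) t := by
        filter_upwards [hmem] with s hs'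
        rw [hz.2.2]
        exact hs'
      have h0 := hmax.hasDerivAt_eq_zero (hd t).1
      have hpos := hessian_pos hk (curvatureForm_pos hk hz (hcrit _ hz))
        (sub_ne_zero.2 hxy.symm) h0
      have hgt := eventually_gt_of_deriv2_pos (fun s => (hd s).1) h0 (hd t).2 hpos
      obtain ⟨s, h1, h2⟩ := (hgt.and (nhdsWithin_le_nhds hmem)).exists
      rw [hz.2.2] at h1
      linarith
    · rw [hs.frontier_eq, wellBody_diff_wellInterior hk]

end Well

/-! ### The sign of the curvature criterion -/

lemma criterion_pos_of_nonpos {m k y : ℝ} (hk : Subcritical m k) (hy : -1 ≤ y) (hy0 : y ≤ 0)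
    (hym : k * y < m) (hR : 0 ≤ k * y ^ 2 - 2 * m * y + 2 - k) : 0 < criterion m k y := by
  have h1 : 0 ≤ (k * y ^ 2 - 2 * m * y + 2 - k) * (y * (k * y - m)) :=
    mul_nonneg hR (mul_nonneg_of_nonpos_of_nonpos hy0 (by linarith))
  rcases hy.eq_or_lt with rfl | hlt
  · unfold criterion
    nlinarith [hk.neg_one_lt, hk.one_lt, mul_pos (by linarith [hk.neg_one_lt] : 0 < 1 + m)
      (by linarith [hk.neg_one_lt, hk.one_lt] : 0 < k + m)]
  · have h2 : 0 < (1 - y ^ 2) * (k ^ 2 - 2 * k + m ^ 2) := mul_pos (by nlinarith) hk.pos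
    unfold criterion
    linarith

/-- The values of `cos nu` over the well. -/
lemma cos_bounds_of_mem_wellSurface {m k : ℝ} (hk : Subcritical m k) {z : Phase}
    (hz : z ∈ wellSurface m k) : k * Real.cos (z 1) < m ∧
      0 ≤ k * Real.cos (z 1) ^ 2 - 2 * m * Real.cos (z 1) + 2 - k := by
  have h1 := hz.2.1
  have h2 := hz.2.2
  have h3 := lamPot_zero_le hk.one_lt (z 0)
  rw [lt_div_iff₀ (by linarith [hk.one_lt])] at h1
  simp only [regEnergy, nuPot] at h2
  constructor
  · linarith
  · nlinarith [sq_nonneg (z 2), sq_nonneg (z 3)]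

lemma criterion_pos_of_m_nonpos {m k : ℝ} (hk : Subcritical m k) (hm : m ≤ 0) {z : Phase}
    (hz : z ∈ wellSurface m k) : 0 < criterion m k (Real.cos (z 1)) := by
  obtain ⟨h1, h2⟩ := cos_bounds_of_mem_wellSurface hk hz
  exact criterion_pos_of_nonpos hk (Real.neg_one_le_cos _)
    (by nlinarith [hk.one_lt]) h1 h2

/-- When the critical point `y = m / (4k)` of the criterion is not over the well, the criterion is
positive. -/
lemma criterion_pos_of_not_over_well {m k y : ℝ} (hk : Subcritical m k) (hy0 : 0 < y)
    (hym : k * y < m) (hR : 0 ≤ k * y ^ 2 - 2 * m * y + 2 - k)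
    (hR1 : k * (m / (4 * k)) ^ 2 - 2 * m * (m / (4 * k)) + 2 - k ≤ 0) :
    0 < criterion m k y := by
  have hk1 := hk.one_lt
  have hm0 : 0 < m := by nlinarith
  have hδ : 9 / 16 * m ^ 2 ≤ k ^ 2 - 2 * k + m ^ 2 := by
    have : k * (k * (m / (4 * k)) ^ 2 - 2 * m * (m / (4 * k)) + 2 - k) ≤ 0 :=
      mul_nonpos_of_nonneg_of_nonpos (by linarith) hR1
    have e : k * (k * (m / (4 * k)) ^ 2 - 2 * m * (m / (4 * k)) + 2 - k)
        = 9 / 16 * m ^ 2 - (k ^ 2 - 2 * k + m ^ 2) := by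
      field_simp
      ring
    linarith
  set δ := k ^ 2 - 2 * k + m ^ 2 with hδd
  set w := m - k * y with hw
  have hw0 : 0 < w := by linarith
  have hkR : k * (k * y ^ 2 - 2 * m * y + 2 - k) = w ^ 2 - δ := by
    rw [hw, hδd]
    ring
  set R := k * y ^ 2 - 2 * m * y + 2 - k with hRd
  have hkR0 : 0 ≤ k * R := by positivity
  have hw1 : 3 / 4 * m ≤ w := by
    nlinarith
  have hy1 : k * y ≤ m / 4 := by linarith
  have hw2 : w ≤ m := by nlinarith
  have hw3 : w ^ 2 ≤ m ^ 2 := pow_le_pow_left₀ hw0.le hw2 2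
  have hkRle : k * R ≤ 7 / 16 * m ^ 2 := by linarith
  have hRle : R ≤ 7 / 16 * m ^ 2 := by nlinarith
  have hyw : y * w ≤ 1 / 4 := by
    have : y ≤ 1 / 4 := by nlinarith [hk.lt_one]
    have : w ≤ 1 := by nlinarith [hk.lt_one]
    nlinarith
  have hyy : y ^ 2 ≤ 1 / 16 := by nlinarith [hk.lt_one]
  have h1 : R * (y * w) ≤ 7 / 16 * m ^ 2 * (1 / 4) :=
    mul_le_mul hRle hyw (by positivity) (by positivity)
  have h2 : 15 / 16 * (9 / 16 * m ^ 2) ≤ (1 - y ^ 2) * δ :=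
    mul_le_mul (by linarith) hδ (by positivity) (by linarith)
  have e : criterion m k y = (1 - y ^ 2) * δ - R * (y * w) := by
    rw [criterion, hw]
    ring
  rw [e]
  nlinarith [pow_pos hm0 2]

/-- If the critical point `y = m / (4k)` of the criterion lies over the well, then the criterion is
smallest there. Its derivative is
`R(y) (4 k y - m)` with `R(y) = k y² - 2 m y + 2 - k`, and `R` is nonnegative over the well. -/
lemma criterion_min_le {m k y : ℝ} (hk : Subcritical m k) (hm : 0 < m) (hym : k * y < m)
    (hR : 0 ≤ k * y ^ 2 - 2 * m * y + 2 - k)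
    (hR1 : 0 ≤ k * (m / (4 * k)) ^ 2 - 2 * m * (m / (4 * k)) + 2 - k) :
    criterion m k (m / (4 * k)) ≤ criterion m k y := by
  have hk1 := hk.one_lt
  set x := m / (4 * k) with hx
  have hmx : m = 4 * k * x := by
    rw [hx]
    field_simp
  have hx0 : 0 < x := by rw [hx]; positivity
  rcases le_total x y with h | h
  · have e : criterion m k y - criterion m k x =
        2 * k * (k * y ^ 2 - 2 * m * y + 2 - k) * (y - x) ^ 2
          + k * (y - x) ^ 3 * (4 * m - 3 * k * y - k * x) / 3 := by
      simp only [criterion]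
      rw [hmx]
      ring
    have h3 : 0 ≤ 4 * m - 3 * k * y - k * x := by nlinarith
    have h4 : 0 ≤ y - x := sub_nonneg.2 h
    have : 0 ≤ 2 * k * (k * y ^ 2 - 2 * m * y + 2 - k) * (y - x) ^ 2
          + k * (y - x) ^ 3 * (4 * m - 3 * k * y - k * x) / 3 := by positivity
    linarith
  · have e : criterion m k y - criterion m k x = 4 * k * (y - x) ^ 2 *
        ((k * x ^ 2 - 2 * m * x + 2 - k) / 2 + (x - y) * (2 * m - 2 * k * x) / 3
          + k * (y - x) ^ 2 / 4) := by
      simp only [criterion]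
      rw [hmx]
      ring
    have h3 : 0 ≤ 2 * m - 2 * k * x := by nlinarith
    have h4 : 0 ≤ x - y := sub_nonneg.2 h
    have : 0 ≤ 4 * k * (y - x) ^ 2 *
        ((k * x ^ 2 - 2 * m * x + 2 - k) / 2 + (x - y) * (2 * m - 2 * k * x) / 3
          + k * (y - x) ^ 2 / 4) := by positivity
    linarith

lemma criterion_pos_of_min_pos {m k : ℝ} (hk : Subcritical m k) (hm : 0 < m)
    (hmin : 0 < criterion m k (m / (4 * k))) {z : Phase} (hz : z ∈ wellSurface m k) :
    0 < criterion m k (Real.cos (z 1)) := by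
  obtain ⟨h1, h2⟩ := cos_bounds_of_mem_wellSurface hk hz
  rcases le_total (k * (m / (4 * k)) ^ 2 - 2 * m * (m / (4 * k)) + 2 - k) 0 with hR | hR
  · rcases le_or_gt (Real.cos (z 1)) 0 with h0 | h0
    · exact criterion_pos_of_nonpos hk (Real.neg_one_le_cos _) h0 h1 h2
    · exact criterion_pos_of_not_over_well hk h0 h1 h2 hR
  · exact hmin.trans_le (criterion_min_le hk hm h1 h2 hR)

lemma criterion_min_eq (m : ℝ) {k : ℝ} (hk : k ≠ 0) : criterion m k (m / (4 * k)) =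
    k ^ 2 - 2 * k + 9 / 8 * m ^ 2 - m ^ 2 / (4 * k) + 5 / 256 * m ^ 4 / k ^ 2 := by
  unfold criterion
  field_simp
  ring

lemma criterion_min_strictMono {m : ℝ} (hm0 : 0 < m) (hm1 : m < 1) :
    StrictMonoOn (fun k => criterion m k (m / (4 * k))) (Ici 1) := by
  intro k hk l hl hkl
  have hk1 : 1 ≤ k := hk
  have hl1 : 1 ≤ l := hl
  have hk0 : 0 < k := by linarith
  have hl0 : 0 < l := by linarith
  have hu1 : k⁻¹ ≤ 1 := inv_le_one_of_one_le₀ hk1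
  have hv1 : l⁻¹ ≤ 1 := inv_le_one_of_one_le₀ hl1
  have huv : l⁻¹ < k⁻¹ := inv_strictAnti₀ hk0 hkl
  have hm2 : m ^ 4 ≤ m ^ 2 := pow_le_pow_of_le_one hm0.le hm1.le (by norm_num)
  have hm4 : 0 < m ^ 4 := by positivity
  have hbr : 0 ≤ m ^ 2 / 4 - 5 / 256 * m ^ 4 * (k⁻¹ + l⁻¹) := by nlinarith
  have e : criterion m l (m / (4 * l)) - criterion m k (m / (4 * k)) =
      (l - k) * (k + l - 2) + (k⁻¹ - l⁻¹) * (m ^ 2 / 4 - 5 / 256 * m ^ 4 * (k⁻¹ + l⁻¹)) := by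
    rw [criterion_min_eq m hk0.ne', criterion_min_eq m hl0.ne']
    field_simp
    ring
  have h1 : 0 < (l - k) * (k + l - 2) := mul_pos (by linarith) (by linarith)
  have h2 := mul_nonneg (sub_pos.2 huv).le hbr
  change criterion m k (m / (4 * k)) < criterion m l (m / (4 * l))
  linarith

/-- For `0 < m < 1` the minimum of the criterion vanishes at some subcritical `k`: it is negative at
the critical energy and positive at `k = 2`. -/
lemma exists_threshold {m : ℝ} (hm0 : 0 < m) (hm1 : m < 1) :
    ∃ k₀, Subcritical m k₀ ∧ criterion m k₀ (m / (4 * k₀)) = 0 := by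
  have hs0 : 0 < √(1 - m ^ 2) := Real.sqrt_pos.2 (by nlinarith)
  have hs2 : √(1 - m ^ 2) ^ 2 = 1 - m ^ 2 := Real.sq_sqrt (by nlinarith)
  have hs1 : √(1 - m ^ 2) < 1 := by nlinarith
  set kc := 1 + √(1 - m ^ 2) with hkc
  have hkc1 : 1 < kc := by linarith
  have hkc2 : kc ^ 2 - 2 * kc + m ^ 2 = 0 := by
    rw [hkc]
    linarith [show (1 + √(1 - m ^ 2)) ^ 2 - 2 * (1 + √(1 - m ^ 2)) + m ^ 2
      = √(1 - m ^ 2) ^ 2 - 1 + m ^ 2 by ring]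
  have hneg : criterion m kc (m / (4 * kc)) < 0 := by
    have e : criterion m kc (m / (4 * kc)) = (kc ^ 2 - 2 * kc + m ^ 2) * (1 + m ^ 2 / (8 * kc ^ 2))
        - m ^ 2 / (8 * kc ^ 2) * (27 / 32 * m ^ 2) := by
      rw [criterion_min_eq m (by linarith)]
      field_simp
      ring
    rw [e, hkc2, zero_mul, zero_sub, neg_lt_zero]
    positivity
  have hpos : 0 < criterion m 2 (m / (4 * 2)) := by
    rw [criterion_min_eq m (by norm_num)]
    have : 0 < m ^ 2 := by positivity
    have : 0 < m ^ 4 := by positivity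
    linarith
  have hcont : ContinuousOn (fun k => criterion m k (m / (4 * k))) (Icc kc 2) := by
    have hne : ∀ k ∈ Icc kc 2, 4 * k ≠ 0 := fun k hk => by
      have := hk.1
      linarith
    unfold criterion
    fun_prop (disch := assumption)
  obtain ⟨k₀, hk₀, h0⟩ := intermediate_value_Ioo (by linarith) hcont ⟨hneg, hpos⟩
  refine ⟨k₀, ⟨by linarith, hm1, by linarith [hk₀.1], ?_⟩, h0⟩
  nlinarith [hk₀.1]

/-! ### Failure of convexity near the critical energy -/

section Well

variable {m k : ℝ} (hk : Subcritical m k)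
include hk

/-- A state over the critical point `y = m / (4k)` of the criterion, with `lam = p_nu = 0`. -/
lemma exists_state_over_min (hm : 0 < m) (hmin : criterion m k (m / (4 * k)) ≤ 0) :
    ∃ z ∈ wellSurface m k, z 0 = 0 ∧ z 3 = 0 ∧ Real.cos (z 1) = m / (4 * k) := by
  have hk1 := hk.one_lt
  set y := m / (4 * k) with hy
  have hmy : m = 4 * k * y := by
    rw [hy]
    field_simp
  have hy0 : 0 < y := by rw [hy]; positivity
  have hy1 : y ≤ 1 := by nlinarith [hk.lt_one]
  have hR : 0 < k * y ^ 2 - 2 * m * y + 2 - k := by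
    by_contra hle
    have h1 : 0 ≤ (k * y ^ 2 - 2 * m * y + 2 - k) * (y * (k * y - m)) :=
      mul_nonneg_of_nonpos_of_nonpos (not_lt.1 hle)
        (mul_nonpos_of_nonneg_of_nonpos hy0.le (by nlinarith))
    have h2 : 0 < (1 - y ^ 2) * (k ^ 2 - 2 * k + m ^ 2) :=
      mul_pos (by nlinarith [hk.lt_one]) hk.pos
    unfold criterion at hmin
    linarith
  have hc : Real.cos (Real.arccos y) = y := Real.cos_arccos (by linarith) hy1
  have hpi := Real.pi_pos
  refine ⟨!₂[0, Real.arccos y, √((k * y ^ 2 - 2 * m * y + 2 - k) / 2), 0],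
    ⟨?_, ?_, ?_⟩, by simp, by simp, by simpa using hc⟩
  · have h1 : 0 ≤ Real.arccos y := Real.arccos_nonneg y
    have h2 := Real.arccos_le_pi y
    have h3 : Real.cos (Real.arccos y) < m / k := by
      rw [hc, lt_div_iff₀ (by linarith)]
      nlinarith
    have := mem_Ioo_of_cos_le hk ⟨h1, by linarith⟩ h3.le
    simpa using this
  · simp only [Matrix.cons_val_one, Matrix.cons_val_zero]
    rw [hc, lt_div_iff₀ (by linarith)]
    nlinarith
  · simp only [regEnergy, lamPot, nuPot, Matrix.cons_val_one, Matrix.cons_val_zero,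
      Matrix.cons_val, Real.cosh_zero, hc]
    rw [Real.sq_sqrt (by linarith)]
    ring

omit hk in
lemma curvatureForm_of_lam_zero {z : Phase} (hz : z ∈ wellSurface m k) (h0 : z 0 = 0) :
    curvatureForm m k z = 4 * criterion m k (Real.cos (z 1)) * lamPotDeriv2 k (z 0) := by
  have h := hz.2.2
  rw [regEnergy, h0, show lamPot k 0 = k - 2 by simp [lamPot]] at h
  have hkin : 4 * (z 2 ^ 2 + z 3 ^ 2) = 2 * (2 - k - nuPot m k (z 1)) := by linarith
  rw [curvatureForm, four_mul_criterion, hkin, h0, show lamPotDeriv k 0 = 0 by simp [lamPotDeriv]]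
  ring

lemma exists_gaussKronecker_nonpos (hm : 0 < m) (hmin : criterion m k (m / (4 * k)) ≤ 0) :
    ∃ z ∈ wellSurface m k, gaussKronecker (regEnergy m k) z ≤ 0 := by
  obtain ⟨z, hz, h0, -, h1⟩ := exists_state_over_min hk hm hmin
  refine ⟨z, hz, ?_⟩
  have hg := gradient_regEnergy_ne_zero hk hz
  have hn : 0 < ‖gradient (regEnergy m k) z‖ := norm_pos_iff.2 hg
  rw [gaussKronecker_regEnergy hg, curvatureForm_of_lam_zero hz h0, h1]
  have := lamPotDeriv2_pos hk.one_lt (z 0)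
  exact mul_nonpos_of_nonneg_of_nonpos (by positivity) (by nlinarith)

omit hk in
/-- A convex body bounded by the surface contains the open well, since the momentum `p_lam` of a
state in the well can be increased and decreased until the surface is reached. -/
lemma wellInterior_subset {C : Set Phase} (hC : Convex ℝ C) (hsub : wellSurface m k ⊆ C) :
    wellInterior m k ⊆ C := by
  rintro z ⟨h1, h2, h3⟩
  set r := √(z 2 ^ 2 - regEnergy m k z / 2) with hr
  have hr2 : r ^ 2 = z 2 ^ 2 - regEnergy m k z / 2 :=
    Real.sq_sqrt (by nlinarith [sq_nonneg (z 2)])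
  have hzr : |z 2| < r := by
    rw [hr, ← Real.sqrt_sq_eq_abs]
    exact Real.sqrt_lt_sqrt (sq_nonneg _) (by linarith)
  have hr0 : 0 < r := (abs_nonneg _).trans_lt hzr
  obtain ⟨hlo, hhi⟩ := abs_lt.1 hzr
  have hmem : ∀ p : ℝ, p ^ 2 = r ^ 2 → (!₂[z 0, z 1, p, z 3] : Phase) ∈ C := by
    refine fun p hp => hsub ⟨by simpa using h1, by simpa using h2, ?_⟩
    simp only [regEnergy, Matrix.cons_val_one, Matrix.cons_val_zero, Matrix.cons_val]
    rw [hp, hr2]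
    simp only [regEnergy]
    ring
  have := hC (hmem r rfl) (hmem (-r) (by ring))
    (a := (r + z 2) / (2 * r)) (b := (r - z 2) / (2 * r))
    (div_nonneg (by linarith) (by linarith)) (div_nonneg (by linarith) (by linarith))
    (by field_simp; ring)
  convert! this using 1
  refine phase_ext ?_ ?_ ?_ ?_ <;> simp <;> field_simp <;> ring

/-- Where the criterion is negative there is a tangent line along which the regularized Hamiltonian
has a strict local maximum at the point of tangency. Points on both sides then lie in the open well,
so that a convex body bounded by the surface would contain the point of tangency in its
interior. -/
lemma not_boundsConvexBody (hm : 0 < m) (hmin : criterion m k (m / (4 * k)) < 0) :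
    ¬ BoundsConvexBody (wellSurface m k) := by
  rintro ⟨C, hCc, -, hCconv, hCf⟩
  obtain ⟨z, hz, h0, h3, h1⟩ := exists_state_over_min hk hm hmin.le
  have hsub : wellSurface m k ⊆ C := hCf ▸ hCc.isClosed.frontier_subset
  have hint : wellInterior m k ⊆ interior C :=
    interior_maximal (wellInterior_subset hCconv hsub) isOpen_wellInterior
  -- The tangent direction in the plane of `nu` and `p_lam`.
  set v : Phase := !₂[0, 4 * z 2, -nuPotDeriv m k (z 1), 0] with hv
  have hd := hasDerivAt_regEnergy_line m k z v
  have hz' : z + (0 : ℝ) • v = z := by simp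
  have hd0 : ∑ i, summandDeriv m k i ((z + (0 : ℝ) • v) i) * v i = 0 := by
    rw [hz', Fin.sum_univ_four]
    simp [summandDeriv, hv]
    ring
  have hd2 : ∑ i, summandDeriv2 m k i ((z + (0 : ℝ) • v) i) * v i ^ 2
      = 16 * criterion m k (m / (4 * k)) := by
    have h := hz.2.2
    rw [regEnergy, h0, h3, show lamPot k 0 = k - 2 by simp [lamPot]] at h
    have hp : z 2 ^ 2 = (2 - k - nuPot m k (z 1)) / 2 := by linarith
    rw [hz', Fin.sum_univ_four, ← h1,
      show 16 * criterion m k (Real.cos (z 1)) = 4 * (4 * criterion m k (Real.cos (z 1))) by ring,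
      four_mul_criterion]
    simp [summandDeriv2, hv, mul_pow, hp]
    ring
  have hlt := eventually_gt_of_deriv2_pos (f := fun s => -regEnergy m k (z + s • v)) (t := 0)
    (fun s => (hd s).1.neg) (by simpa using hd0) (hd 0).2.neg (by rw [hd2]; linarith)
  have hc : Continuous fun s : ℝ => z + s • v := by fun_prop
  have hmem : ∀ᶠ s in nhdsWithin (0 : ℝ) {0}ᶜ, z + s • v ∈ wellInterior m k := by
    have h4 : Continuous fun s : ℝ => (z + s • v) 1 := by fun_prop
    have e1 : ∀ᶠ s in nhds (0 : ℝ), (z + s • v) 1 ∈ Ioo 0 (2 * Real.pi) :=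
      h4.continuousAt.eventually_mem (isOpen_Ioo.mem_nhds (by simpa using hz.1))
    have e2 : ∀ᶠ s in nhds (0 : ℝ), Real.cos ((z + s • v) 1) < m / k :=
      (Real.continuous_cos.comp h4).continuousAt.eventually_lt continuousAt_const
        (by simpa using hz.2.1)
    filter_upwards [hlt, nhdsWithin_le_nhds e1, nhdsWithin_le_nhds e2] with s hs hs1 hs2
    refine ⟨hs1, hs2, ?_⟩
    rw [hz', hz.2.2] at hs
    linarith
  have hneg : Filter.Tendsto (fun s : ℝ => -s) (nhdsWithin 0 {0}ᶜ) (nhdsWithin 0 {0}ᶜ) := by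
    refine tendsto_nhdsWithin_iff.2 ⟨?_, ?_⟩
    · exact ((continuous_neg.tendsto' (0 : ℝ) 0 (by simp)).mono_left nhdsWithin_le_nhds)
    · filter_upwards [self_mem_nhdsWithin] with s hs
      simpa using hs
  obtain ⟨s, hs1, hs2⟩ := (hmem.and (hneg.eventually hmem)).exists
  have hzint : z ∈ interior C := by
    have := hCconv.interior (hint hs1) (hint hs2) (a := 1 / 2) (b := 1 / 2) (by norm_num)
      (by norm_num) (by norm_num)
    convert! this using 1
    module
  rw [← hCf] at hz
  exact hz.2 hzint

end Well

end TwoCentre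

end

open TwoCentre in
theorem theorem1p1 (μ : ℝ) (hμ0 : 0 < μ) (hμ1 : μ < 1) :
    -- the elliptic coordinates are a smooth symplectic 2-to-1 map onto the phase space
    (ContDiffOn ℝ ∞ ellipticMap ellipticDomain ∧
      (∀ z : Phase,
        dist (position (ellipticMap z)) earth + dist (position (ellipticMap z)) moon
            = Real.cosh (z 0) ∧
        dist (position (ellipticMap z)) earth - dist (position (ellipticMap z)) moon
            = Real.cos (z 1)) ∧
      (∀ z ∈ ellipticDomain, ∀ v : Phase,
        liouville (ellipticMap z) (fderiv ℝ ellipticMap z v) = liouville z v) ∧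
      (∀ z ∈ ellipticDomain, ∀ v w : Phase,
        symplecticForm (fderiv ℝ ellipticMap z v) (fderiv ℝ ellipticMap z w)
          = symplecticForm v w) ∧
      (∀ x ∈ phaseSpace,
        {z : Phase | z 1 ∈ Ico 0 (2 * Real.pi) ∧ ellipticMap z = x}.ncard = 2)) ∧
    -- the regularization, and the regularized Earth component as a 2-to-1 cover
    (∀ c : ℝ, c < criticalEnergy μ →
      (∀ z ∈ ellipticDomain, regHamiltonian μ c z =
        (hamiltonian μ (ellipticMap z) - c) * (Real.cosh (z 0) ^ 2 - Real.cos (z 1) ^ 2)) ∧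
      IsCompact (regEarthComponent μ c) ∧
      (∃ z ∈ regEarthComponent μ c,
        regEarthComponent μ c = connectedComponentIn {y | regHamiltonian μ c y = 0} z) ∧
      (∀ z ∈ regEarthComponent μ c, gradient (regHamiltonian μ c) z ≠ 0) ∧
      ellipticMap '' (regEarthComponent μ c ∩ ellipticDomain) = earthComponent μ c ∧
      (∀ z ∈ regEarthComponent μ c, deck z ∈ regEarthComponent μ c ∧ deck z ≠ z) ∧
      (∀ z ∈ regEarthComponent μ c ∩ ellipticDomain,
        {y ∈ regEarthComponent μ c ∩ ellipticDomain | ellipticMap y = ellipticMap z}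
          = {z, deck z})) ∧
    -- the Earth is the lighter body, or the bodies have equal mass
    (1 / 2 ≤ μ → ∀ c : ℝ, c < criticalEnergy μ →
      IsStrictlyConvexHypersurface (regHamiltonian μ c) (regEarthComponent μ c)) ∧
    -- the Earth is the heavier body
    (μ < 1 / 2 → ∃ c₀ : ℝ, c₀ < criticalEnergy μ ∧
      (∀ c : ℝ, c < c₀ →
        IsStrictlyConvexHypersurface (regHamiltonian μ c) (regEarthComponent μ c)) ∧
      (∀ c : ℝ, c₀ ≤ c → c < criticalEnergy μ →
        ∃ z ∈ regEarthComponent μ c, gaussKronecker (regHamiltonian μ c) z ≤ 0) ∧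
      (∀ c : ℝ, c₀ < c → c < criticalEnergy μ →
        ¬ BoundsConvexBody (regEarthComponent μ c))) := by
  refine ⟨⟨contDiffOn_ellipticMap, fun z => ⟨?_, ?_⟩, fun z hz v => liouville_ellipticMap hz v,
    fun z hz v w => symplecticForm_ellipticMap hz v w, fun x hx => ncard_fibre hx⟩,
    fun c hc => ?_, fun hμ c hc => ?_, fun hμ => ?_⟩
  · rw [dist_ellipticMap_earth, dist_ellipticMap_moon]
    ring
  · exact (cos_eq_dist_sub_dist z).symm
  · have hk := subcritical_of_lt hμ0 hμ1 hc
    rw [regEarthComponent_eq hk, regHamiltonian_eq]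
    exact ⟨fun z hz => regEnergy_eq_hamiltonian hz, isCompact_wellSurface hk,
      ⟨_, collision_mem_wellSurface hk,
        wellSurface_eq_connectedComponentIn hk (collision_mem_wellSurface hk)⟩,
      fun z hz => gradient_regEnergy_ne_zero hk hz, image_wellSurface hk,
      fun z hz => deck_mem_wellSurface hk hz, fun z hz => fibre_wellSurface hk hz⟩
  · have hk := subcritical_of_lt hμ0 hμ1 hc
    rw [regEarthComponent_eq hk, regHamiltonian_eq]
    exact isStrictlyConvexHypersurface_well hk fun z hz =>
      criterion_pos_of_m_nonpos hk (by linarith) hz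
  · have hm0 : 0 < 1 - 2 * μ := by linarith
    have hm1 : 1 - 2 * μ < 1 := by linarith
    obtain ⟨k₀, hk₀, h0⟩ := exists_threshold hm0 hm1
    have hmono := criterion_min_strictMono hm0 hm1
    have hc₀ := lt_criticalEnergy hμ0 hμ1 hk₀
    refine ⟨-k₀, hc₀, fun c hc => ?_, fun c hc hcJ => ?_, fun c hc hcJ => ?_⟩
    · have hk := subcritical_of_lt hμ0 hμ1 (hc.trans hc₀)
      rw [regEarthComponent_eq hk, regHamiltonian_eq]
      refine isStrictlyConvexHypersurface_well hk fun z hz =>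
        criterion_pos_of_min_pos hk hm0 ?_ hz
      rw [← h0]
      exact hmono hk₀.one_lt.le hk.one_lt.le (by linarith)
    · have hk := subcritical_of_lt hμ0 hμ1 hcJ
      rw [regEarthComponent_eq hk, regHamiltonian_eq]
      refine exists_gaussKronecker_nonpos hk hm0 ?_
      rw [← h0]
      exact hmono.monotoneOn hk.one_lt.le hk₀.one_lt.le (by linarith)
    · have hk := subcritical_of_lt hμ0 hμ1 hcJ
      rw [regEarthComponent_eq hk]
      refine not_boundsConvexBody hk hm0 ?_
      rw [← h0]
      exact hmono hk.one_lt.le hk₀.one_lt.le (by linarith)
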